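/- Let $\Omega\subseteq\mathbb R^n$ be open and let $(a_{ij}(x))$ be a $C^\infty$ field of symmetric positive definite matrices on $\Omega$, with inverse $(a^{ij}(x))$. Let $U\subseteq\Omega\times\Omega$ be an open set containing the diagonal (for instance $U=\Omega\times\Omega$) and let $d^2:U\to\mathbb R$ be a $C^\infty$ solution of $$d^2=\tfrac14\sum_{ij}a_{ij}(x)\,\partial_{x_i}d^2\,\partial_{x_j}d^2,\qquad d^2=\tfrac14\sum_{ij}a_{ij}(y)\,\partial_{y_i}d^2\,\partial_{y_j}d^2 ,\qquad d^2(x,y)=0\iff x=y .$$ Let $y\in\Omega$. Then the following hold. (1) For every $M\ge 3$ and every $x$ such that $(y+\theta\Delta x,y)\in U$ for all $\theta\in[0,1]$, where $\Delta x=x-y$, $$d^2(x,y)=\sum_{ij}a^{ij}(y)\Delta x^i\Delta x^j+\sum_{3\le|\alpha|<M}\frac{\partial_x^\alpha d^2(y,y)}{\alpha!}\Delta x^\alpha+M\sum_{|\gamma|=M}\int_0^1(1-\theta)^{M-1}\frac{\Delta x^\gamma}{\gamma!}\,\partial_x^\gamma d^2(y+\theta\Delta x,y)\,d\theta ,$$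 and the integrands are integrable. (2) There are an orthogonal matrix $Q$ and numbers $\lambda_1,\dots,\lambda_n$ (the spectrum of $(a^{ij}(y))$) with $Q^{T}(a^{ij}(y))Q=\mathrm{diag}(\lambda_i)$, so that in the coordinates $z$ given by $x=y+Qz$ the second-order term is $\sum_i\lambda_iz_i^2$. For every such $Q,\lambda$ put $\tilde a(z)=Q^{T}a(y+Qz)Q$, $\tilde a_{ij}^{\alpha}=\partial^\alpha\tilde a_{ij}(0)$ and $d^2_\beta=\frac1{\beta!}\partial_z^\beta\big[d^2(y+Qz,y)\big]_{z=0}$. With $1_i$ the $i$-th unit multi-index, the coefficients $(d^2_\beta)_{|\beta|\ge3}$ satisfy, for all $|\beta|\ge 3$, $$d^2_\beta=\frac1{1-|\beta|}\Big(\sum_{i,j:\,1_i+1_j\le\beta}\lambda_i\lambda_j\frac{\tilde a_{ij}^{\beta-1_i-1_j}}{(\beta-1_i-1_j)!}+\sum_{i,j}\ \sum_{\substack{|\alpha|\ge1,\ |\gamma|\ge3\\ \alpha+1_i+\gamma=\beta+1_j}}\frac{\tilde a_{ij}^{\alpha}}{\alpha!}\lambda_i\gamma_j d^2_\gamma+\frac14\sum_{i,j}\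 \sum_{\substack{|\delta|\ge3,\ |\gamma|\ge3\\ \alpha+\delta+\gamma=\beta+1_i+1_j}}\frac{\tilde a_{ij}^{\alpha}}{\alpha!}\delta_i\gamma_j d^2_\delta d^2_\gamma\Big),$$ and they are the only family of real numbers indexed by $|\beta|\ge3$ that does. (3) If in these coordinates $\tilde a(z)=\mathrm{diag}(\mu_1(z),\dots,\mu_n(z))$ for $z$ near $0$, then with $\mu_i^\alpha=\partial^\alpha\mu_i(0)$ the $(d^2_\beta)_{|\beta|\ge3}$ are likewise the unique family that satisfies, for all $|\beta|\ge3$, $$d^2_\beta=\frac1{1-|\beta|}\Big(\sum_{i:\,\beta_i\ge2}\lambda_i^2\frac{\mu_i^{\beta-2\cdot1_i}}{(\beta-2\cdot1_i)!}+\sum_i\ \sum_{\substack{|\alpha|\ge1,\ |\gamma|\ge3\\ \alpha+\gamma=\beta}}\frac{\mu_i^\alpha}{\alpha!}\lambda_i\gamma_id^2_\gamma+\frac14\sum_i\ \sum_{\substack{|\delta|\ge3,\ |\gamma|\ge3\\ \alpha+\gamma+\delta=\beta+2\cdot1_i}}\frac{\mu_i^\alpha}{\alpha!}\delta_i\gamma_id^2_\delta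 d^2_\gamma\Big).$$ (4) Any two $C^\infty$ solutions, each on some open set $U\subseteq\Omega\times\Omega$ containing the diagonal, coincide in a neighbourhood of $(y,y)$. Moreover, in general $d^2$ is not globally analytic: for every $n\ge1$ there is a real-analytic field $(a_{ij})$ of symmetric positive definite matrices on $\mathbb R^n$ for which the system above has a $C^\infty$ solution on $\mathbb R^n\times\mathbb R^n$, while for no such solution $d^2$ does every function $x\mapsto d^2(x,y)$, $y\in\mathbb R^n$, have a power series representation $\sum_\alpha c_\alpha(y)(x-y)^\alpha$ that converges to $d^2(x,y)$ for all $x\in\mathbb R^n$. -/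

import Mathlib

open Set Filter Topology MeasureTheory
open scoped Matrix ContDiff

noncomputable section

namespace Eikonal

variable {n : ℕ}

/-! ### Multi-index calculus on `ℝⁿ`; a multi-index is a function `Fin n → ℕ` -/

/-- The length `|α| = α₁ + ⋯ + αₙ` of a multi-index. -/
def deg (α : Fin n → ℕ) : ℕ := ∑ i, α i

/-- The factorial `α! = α₁! ⋯ αₙ!` of a multi-index. -/
def mfact (α : Fin n → ℕ) : ℕ := ∏ i, (α i).factorial

/-- The monomial `h^α = h₁^{α₁} ⋯ hₙ^{αₙ}`. -/
def mpow (h : Fin n → ℝ) (α : Fin n → ℕ) : ℝ := ∏ i, h i ^ α i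

/-- The unit multi-index `1_i`. -/
def unit (i : Fin n) : Fin n → ℕ := Pi.single i 1

/-- The partial derivative `∂f/∂xᵢ`. -/
def pderiv (i : Fin n) (f : (Fin n → ℝ) → ℝ) : (Fin n → ℝ) → ℝ :=
  fun x => fderiv ℝ f x (Pi.single i 1)

/-- The multivariate derivative `∂^α f = ∂₁^{α₁} ⋯ ∂ₙ^{αₙ} f`. -/
def mderiv (α : Fin n → ℕ) (f : (Fin n → ℝ) → ℝ) : (Fin n → ℝ) → ℝ :=
  (List.finRange n).foldr (fun i g => (pderiv i)^[α i] g) f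

/-- The Taylor coefficient `∂^α f(p) / α!`. -/
def taylorCoeff (f : (Fin n → ℝ) → ℝ) (p : Fin n → ℝ) (α : Fin n → ℕ) : ℝ :=
  mderiv α f p / (mfact α : ℝ)

/-! ### The eikonal system -/

/-- `(a_{ij})` is a smooth field of symmetric positive definite matrices on `Ω`. -/
structure IsCoefficientField (a : (Fin n → ℝ) → Matrix (Fin n) (Fin n) ℝ)
    (Ω : Set (Fin n → ℝ)) : Prop where
  smooth : ∀ i j, ContDiffOn ℝ ∞ (fun x => a x i j) Ω
  posDef : ∀ x ∈ Ω, (a x).PosDef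

/-- `D` (the function `d²`) is a smooth solution, on the open neighbourhood `U` of the diagonal of
`Ω × Ω`, of the eikonal equation in `x` and in `y`, with the boundary condition
`d(x,y) = 0 ↔ x = y`. The case `U = Ω × Ω` is allowed. -/
structure IsSolution (a : (Fin n → ℝ) → Matrix (Fin n) (Fin n) ℝ) (Ω : Set (Fin n → ℝ))
    (U : Set ((Fin n → ℝ) × (Fin n → ℝ))) (D : (Fin n → ℝ) → (Fin n → ℝ) → ℝ) : Prop where
  isOpen : IsOpen U
  subset : U ⊆ Ω ×ˢ Ω
  diag : ∀ y ∈ Ω, (y, y) ∈ U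
  smooth : ContDiffOn ℝ ∞ (fun p : (Fin n → ℝ) × (Fin n → ℝ) => D p.1 p.2) U
  eikonal_x : ∀ x y, (x, y) ∈ U → D x y = 1 / 4 * ∑ i, ∑ j,
    a x i j * pderiv i (fun x' => D x' y) x * pderiv j (fun x' => D x' y) x
  eikonal_y : ∀ x y, (x, y) ∈ U → D x y = 1 / 4 * ∑ i, ∑ j,
    a y i j * pderiv i (fun y' => D x y') y * pderiv j (fun y' => D x y') y
  boundary : ∀ x y, (x, y) ∈ U → (D x y = 0 ↔ x = y)

/-! ### Coordinates `z` at `y` with `x = y + Q z`, for an orthogonal matrix `Q` -/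

/-- The orthogonal coordinates given by `Q` put the second order term at `y` into normal form:
`∑ a^{ij}(y) Δxⁱ Δxʲ = ∑ lam i * zᵢ²`, where `(a^{ij})` is the inverse of `(a_{ij})`. As `Q` is
orthogonal, `lam` lists the spectrum of `(a^{ij}(y))`. -/
def IsNormalForm (a : (Fin n → ℝ) → Matrix (Fin n) (Fin n) ℝ) (y : Fin n → ℝ)
    (Q : Matrix (Fin n) (Fin n) ℝ) (lam : Fin n → ℝ) : Prop :=
  Q ∈ Matrix.orthogonalGroup (Fin n) ℝ ∧ Qᵀ * (a y)⁻¹ * Q = Matrix.diagonal lam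

/-- The coefficient field `(a_{ij})` in the coordinates `z`. -/
def coeffInCoords (a : (Fin n → ℝ) → Matrix (Fin n) (Fin n) ℝ) (y : Fin n → ℝ)
    (Q : Matrix (Fin n) (Fin n) ℝ) : (Fin n → ℝ) → Matrix (Fin n) (Fin n) ℝ :=
  fun z => Qᵀ * a (y + Q *ᵥ z) * Q

/-- The function `x ↦ D x y` in the coordinates `z`. -/
def solInCoords (D : (Fin n → ℝ) → (Fin n → ℝ) → ℝ) (y : Fin n → ℝ)
    (Q : Matrix (Fin n) (Fin n) ℝ) : (Fin n → ℝ) → ℝ :=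
  fun z => D (y + Q *ᵥ z) y

/-- The right-hand side of the multi-index recursion at `β`, for a coefficient field `A` with
`A 0 = diag (1 / lam i)` and a candidate family `e` of coefficients of order `≥ 3`. -/
def recursionRHS (lam : Fin n → ℝ) (A : (Fin n → ℝ) → Matrix (Fin n) (Fin n) ℝ)
    (e : (Fin n → ℕ) → ℝ) (β : Fin n → ℕ) : ℝ :=
  1 / (1 - (deg β : ℝ)) *
    ((∑ i, ∑ j, if ∀ k, (unit i + unit j) k ≤ β k then
        lam i * lam j * taylorCoeff (fun z => A z i j) 0 (β - (unit i + unit j)) else 0)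
    + (∑ i, ∑ j, ∑ p ∈ (Finset.Iic (β + unit j) ×ˢ Finset.Iic (β + unit j)).filter
          (fun p => 1 ≤ deg p.1 ∧ 3 ≤ deg p.2 ∧ p.1 + unit i + p.2 = β + unit j),
        taylorCoeff (fun z => A z i j) 0 p.1 * lam i * (p.2 j : ℝ) * e p.2)
    + 1 / 4 * ∑ i, ∑ j, ∑ p ∈ (Finset.Iic (β + unit i + unit j) ×ˢ
          (Finset.Iic (β + unit i + unit j) ×ˢ Finset.Iic (β + unit i + unit j))).filter
          (fun p => 3 ≤ deg p.2.1 ∧ 3 ≤ deg p.2.2 ∧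
            p.1 + p.2.1 + p.2.2 = β + unit i + unit j),
        taylorCoeff (fun z => A z i j) 0 p.1 * (p.2.1 i : ℝ) * (p.2.2 j : ℝ)
          * e p.2.1 * e p.2.2)

/-- The right-hand side of the multi-index recursion at `β` in the case of an equation in diagonal
form `d² = 1/4 ∑ᵢ mu i · (∂ᵢ d²)²` with functions `mu i`, `mu i 0 = 1 / lam i`. -/
def diagonalRecursionRHS (lam : Fin n → ℝ) (mu : Fin n → (Fin n → ℝ) → ℝ)
    (e : (Fin n → ℕ) → ℝ) (β : Fin n → ℕ) : ℝ :=
  1 / (1 - (deg β : ℝ)) *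
    ((∑ i, if 2 ≤ β i then lam i ^ 2 * taylorCoeff (mu i) 0 (β - 2 • unit i) else 0)
    + (∑ i, ∑ p ∈ (Finset.Iic β ×ˢ Finset.Iic β).filter
          (fun p => 1 ≤ deg p.1 ∧ 3 ≤ deg p.2 ∧ p.1 + p.2 = β),
        taylorCoeff (mu i) 0 p.1 * lam i * (p.2 i : ℝ) * e p.2)
    + 1 / 4 * ∑ i, ∑ p ∈ (Finset.Iic (β + 2 • unit i) ×ˢ
          (Finset.Iic (β + 2 • unit i) ×ˢ Finset.Iic (β + 2 • unit i))).filter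
          (fun p => 3 ≤ deg p.2.1 ∧ 3 ≤ deg p.2.2 ∧ p.1 + p.2.1 + p.2.2 = β + 2 • unit i),
        taylorCoeff (mu i) 0 p.1 * (p.2.1 i : ℝ) * (p.2.2 i : ℝ) * e p.2.1 * e p.2.2)

/-! ### Global analyticity -/

/-- For each `y` the function `x ↦ D x y` is represented on the whole of `ℝⁿ` by one convergent
power series in `x - y`. -/
def IsGloballyAnalytic (D : (Fin n → ℝ) → (Fin n → ℝ) → ℝ) : Prop :=
  ∀ y, ∃ c : (Fin n → ℕ) → ℝ, ∀ x, HasSum (fun α => c α * mpow (x - y) α) (D x y)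

end Eikonal

end

open Eikonal

namespace Eikonal

variable {n : ℕ}

/-! ### Partial derivatives of functions that are smooth on an open set -/

section Calculus

variable {V : Set (Fin n → ℝ)} {f g : (Fin n → ℝ) → ℝ}

/-! Freezing the second argument turns the statement into one about a single function: `f = D(·, y)`
satisfies `f = ¼⟨A∇f, ∇f⟩` and vanishes only at the source `p = y` (`IsLocalSolution`). Definiteness
of `A` gives `∇f(p) = 0`. Differentiating the equation twice at `p` then gives `H A H = 2H` for the
Hessian `H`, so `H = 2A⁻¹` as soon as `H` is invertible.

Invertibility and local uniqueness both come from a comparison principle (`le_of_eikonal`). Formally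
`√F` has `A`-gradient norm at most 1 for a subsolution `F`, and `√G` has norm exactly 1 for a
solution `G`. Flowing along `-A∇G` therefore shows `F ≤ G` on a small sublevel set of `G`. With `F =
c|x - p|²` this yields quadratic growth, which excludes a kernel of `H`. With two solutions in both
roles it yields equality near the diagonal.

For the recursion, compare the coefficients of `z^β` in the equation (`four_mul_taylorCoeff`) and
split each factor `δ_i d²_δ` into its quadratic part, known from `H`, and its part of order at least
three. The mixed products with `α = 0` contribute `4|β| d²_β`. Moving this to the left produces the
factor `1 - |β|`, and only coefficients of order below `|β|` remain, so the recursion determines the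
family.

For the failure of global analyticity, take `a = diag((1 + xᵢ²)²)`, which is Euclidean in the
coordinates `arctan xᵢ`. By local uniqueness every solution with source `0` equals `arctan² t` along
an axis near `0`, and a power series converging on all of that axis would extend this function to an
entire one. The differential equation of `arctan²` excludes this at `z = i`. -/

theorem contDiffOn_pderiv (hV : IsOpen V) (hf : ContDiffOn ℝ ∞ f V) (i : Fin n) :
    ContDiffOn ℝ ∞ (pderiv i f) V :=
  (hf.fderiv_of_isOpen hV (m := ∞) (by simp)).clm_apply contDiffOn_const

theorem differentiableAt_of_contDiffOn (hV : IsOpen V) (hf : ContDiffOn ℝ ∞ f V)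
    {x : Fin n → ℝ} (hx : x ∈ V) : DifferentiableAt ℝ f x :=
  (hf.contDiffAt (hV.mem_nhds hx)).differentiableAt (by simp)

theorem pderiv_congr_of_eventuallyEq {x : Fin n → ℝ} (h : f =ᶠ[𝓝 x] g) (i : Fin n) :
    pderiv i f x = pderiv i g x := by
  simp only [pderiv, h.fderiv_eq]

theorem pderiv_eqOn (hV : IsOpen V) (h : EqOn f g V) (i : Fin n) :
    EqOn (pderiv i f) (pderiv i g) V := fun _ hx =>
  pderiv_congr_of_eventuallyEq (h.eventuallyEq_of_mem (hV.mem_nhds hx)) i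

theorem pderiv_comm (hV : IsOpen V) (hf : ContDiffOn ℝ ∞ f V) (i j : Fin n) :
    EqOn (pderiv i (pderiv j f)) (pderiv j (pderiv i f)) V := by
  intro x hx
  have hs : IsSymmSndFDerivAt ℝ f x :=
    (hf.contDiffAt (hV.mem_nhds hx)).isSymmSndFDerivAt (by
      simpa using WithTop.coe_le_coe.2 (le_top (a := (2 : ℕ∞))))
  have hd : DifferentiableAt ℝ (fderiv ℝ f) x :=
    ((hf.fderiv_of_isOpen hV (m := ∞) (by simp)).contDiffAt
      (hV.mem_nhds hx)).differentiableAt (by simp)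
  have key : ∀ k l : Fin n, pderiv k (pderiv l f) x =
      fderiv ℝ (fderiv ℝ f) x (Pi.single k 1) (Pi.single l 1) := by
    intro k l
    have := hd.hasFDerivAt.clm_apply (hasFDerivAt_const (Pi.single l 1 : Fin n → ℝ) x)
    change fderiv ℝ (fun x => fderiv ℝ f x (Pi.single l 1)) x (Pi.single k 1) = _
    rw [this.fderiv]
    simp
  rw [key, key, hs]

theorem pderiv_add (hV : IsOpen V) (hf : ContDiffOn ℝ ∞ f V) (hg : ContDiffOn ℝ ∞ g V)
    (i : Fin n) :
    EqOn (pderiv i (fun x => f x + g x)) (fun x => pderiv i f x + pderiv i g x) V := by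
  intro x hx
  have := (differentiableAt_of_contDiffOn hV hf hx).hasFDerivAt.add
    (differentiableAt_of_contDiffOn hV hg hx).hasFDerivAt
  simp only [pderiv]
  rw [HasFDerivAt.fderiv (f := fun x => f x + g x) this]
  simp

theorem pderiv_const_mul (hV : IsOpen V) (hf : ContDiffOn ℝ ∞ f V) (c : ℝ) (i : Fin n) :
    EqOn (pderiv i (fun x => c * f x)) (fun x => c * pderiv i f x) V := by
  intro x hx
  have := (differentiableAt_of_contDiffOn hV hf hx).hasFDerivAt.const_mul c
  simp only [pderiv]
  rw [this.fderiv]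
  simp

theorem pderiv_mul (hV : IsOpen V) (hf : ContDiffOn ℝ ∞ f V) (hg : ContDiffOn ℝ ∞ g V)
    (i : Fin n) :
    EqOn (pderiv i (fun x => f x * g x)) (fun x => pderiv i f x * g x + f x * pderiv i g x) V := by
  intro x hx
  have := (differentiableAt_of_contDiffOn hV hf hx).hasFDerivAt.mul
    (differentiableAt_of_contDiffOn hV hg hx).hasFDerivAt
  simp only [pderiv]
  rw [HasFDerivAt.fderiv (f := fun x => f x * g x) this]
  simp
  ring

theorem fderiv_apply_eq_sum (f : (Fin n → ℝ) → ℝ) (x h : Fin n → ℝ) :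
    fderiv ℝ f x h = ∑ i, h i * pderiv i f x := by
  have h3 : h = ∑ i, h i • (Pi.single i 1 : Fin n → ℝ) := by
    ext k
    simp [Finset.sum_apply, Pi.single_apply]
  have h4 : fderiv ℝ f x h = fderiv ℝ f x (∑ i, h i • (Pi.single i 1 : Fin n → ℝ)) := by
    rw [← h3]
  rw [h4, map_sum]
  simp [pderiv]

/-- The derivative along a line in terms of the partial derivatives. -/
theorem hasDerivAt_comp_line {y h : Fin n → ℝ} {t : ℝ}
    (hf : DifferentiableAt ℝ f (y + t • h)) :
    HasDerivAt (fun s : ℝ => f (y + s • h)) (∑ i, h i * pderiv i f (y + t • h)) t := by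
  have h1 : HasDerivAt (fun s : ℝ => y + s • h) h t := by
    simpa using ((hasDerivAt_id t).smul_const h).const_add y
  rw [← fderiv_apply_eq_sum]
  exact hf.hasFDerivAt.comp_hasDerivAt t h1

theorem pderiv_sum {ι : Type*} (s : Finset ι) {g : ι → (Fin n → ℝ) → ℝ} (hV : IsOpen V)
    (hg : ∀ k, ContDiffOn ℝ ∞ (g k) V) (i : Fin n) :
    EqOn (pderiv i (fun x => ∑ k ∈ s, g k x)) (fun x => ∑ k ∈ s, pderiv i (g k) x) V := by
  intro x hx
  have := HasFDerivAt.fun_sum fun k (_ : k ∈ s) =>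
    (differentiableAt_of_contDiffOn hV (hg k) hx).hasFDerivAt
  simp only [pderiv]
  rw [this.fderiv]
  simp

/-- Since `b` and `c` vanish at `p`, only terms in which each of them receives one derivative
survive. In the application they are first derivatives of a solution at its source. -/
theorem pderiv_pderiv_mul_mul {a b c : (Fin n → ℝ) → ℝ} {p : Fin n → ℝ} (hV : IsOpen V) (hp : p ∈ V)
    (ha : ContDiffOn ℝ ∞ a V) (hb : ContDiffOn ℝ ∞ b V) (hc : ContDiffOn ℝ ∞ c V)
    (hbp : b p = 0) (hcp : c p = 0) (i j : Fin n) :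
    pderiv i (pderiv j (fun x => a x * b x * c x)) p =
      a p * (pderiv i b p * pderiv j c p + pderiv j b p * pderiv i c p) := by
  have d := fun {g : (Fin n → ℝ) → ℝ} (hg : ContDiffOn ℝ ∞ g V) (k : Fin n) =>
    contDiffOn_pderiv hV hg k
  have e1 : EqOn (pderiv j (fun x => a x * b x * c x)) (fun x =>
      (pderiv j (fun x => a x * b x) x) * c x + (a x * b x) * pderiv j c x) V :=
    pderiv_mul hV (ha.mul hb) hc j
  have hab := ha.mul hb
  rw [pderiv_eqOn hV e1 i hp, pderiv_add hV ((d hab j).mul hc) (hab.mul (d hc j)) i hp]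
  simp only
  rw [pderiv_mul hV (d hab j) hc i hp, pderiv_mul hV hab (d hc j) i hp]
  simp only
  rw [pderiv_mul hV ha hb i hp, pderiv_mul hV ha hb j hp]
  simp only [hbp, hcp]
  ring

end Calculus

/-! ### Multi-indices -/

theorem deg_add (α β : Fin n → ℕ) : deg (α + β) = deg α + deg β := by
  simp [deg, Finset.sum_add_distrib]

theorem deg_zero : deg (0 : Fin n → ℕ) = 0 := by simp [deg]

theorem deg_unit (i : Fin n) : deg (unit i) = 1 := by
  simp [deg, unit]

theorem deg_eq_zero {α : Fin n → ℕ} : deg α = 0 ↔ α = 0 := by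
  simp [deg, funext_iff]

theorem exists_eq_add_unit {α : Fin n → ℕ} {i : Fin n} (h : α i ≠ 0) :
    ∃ γ, α = γ + unit i := by
  refine ⟨α - unit i, funext fun k => ?_⟩
  by_cases hk : k = i
  · subst hk; simp [unit]; omega
  · simp [unit, hk]

/-- Induction on multi-indices by adding unit multi-indices. -/
theorem multiIndex_induction {P : (Fin n → ℕ) → Prop} (zero : P 0)
    (add_unit : ∀ α i, P α → P (α + unit i)) (α : Fin n → ℕ) : P α := by
  induction hk : deg α generalizing α with
  | zero => rw [deg_eq_zero.1 hk]; exact zero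
  | succ k ih =>
    obtain ⟨i, hi⟩ : ∃ i, α i ≠ 0 := by
      by_contra! h
      rw [deg_eq_zero.2 (funext h)] at hk
      omega
    obtain ⟨γ, rfl⟩ := exists_eq_add_unit hi
    rw [deg_add, deg_unit] at hk
    exact add_unit γ i (ih γ (by omega))

theorem mfact_zero : mfact (0 : Fin n → ℕ) = 1 := by simp [mfact]

theorem mfact_add_unit (α : Fin n → ℕ) (i : Fin n) :
    mfact (α + unit i) = (α i + 1) * mfact α := by
  unfold mfact
  rw [← Finset.mul_prod_erase _ _ (Finset.mem_univ i),
    ← Finset.mul_prod_erase Finset.univ (fun j => (α j).factorial) (Finset.mem_univ i)]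
  rw [Finset.prod_congr rfl (g := fun j => (α j).factorial)]
  · simp [unit, Nat.factorial_succ, mul_assoc]
  · intro j hj
    simp [unit, Finset.ne_of_mem_erase hj]

theorem mfact_pos (α : Fin n → ℕ) : 0 < mfact α :=
  Finset.prod_pos fun _ _ => Nat.factorial_pos _

theorem mpow_add_unit (h : Fin n → ℝ) (α : Fin n → ℕ) (i : Fin n) :
    mpow h (α + unit i) = h i * mpow h α := by
  unfold mpow
  simp only [Pi.add_apply, pow_add, Finset.prod_mul_distrib]
  rw [mul_comm]
  congr 1
  rw [Finset.prod_eq_single i]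
  · simp [unit]
  · intro j _ hj
    simp [unit, hj]
  · simp

/-! ### Iterated partial derivatives -/

section Iterated

variable {V : Set (Fin n → ℝ)}

/-- The derivatives `∂^α` restricted to the directions in a list. -/
noncomputable def listDeriv (l : List (Fin n)) (α : Fin n → ℕ) (f : (Fin n → ℝ) → ℝ) : (Fin n → ℝ) → ℝ :=
  l.foldr (fun i g => (pderiv i)^[α i] g) f

theorem contDiffOn_iterate_pderiv (hV : IsOpen V) {f : (Fin n → ℝ) → ℝ}
    (hf : ContDiffOn ℝ ∞ f V) (i : Fin n) (k : ℕ) :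
    ContDiffOn ℝ ∞ ((pderiv i)^[k] f) V := by
  induction k with
  | zero => exact hf
  | succ k ih => rw [Function.iterate_succ_apply']; exact contDiffOn_pderiv hV ih i

theorem iterate_pderiv_eqOn (hV : IsOpen V) {f g : (Fin n → ℝ) → ℝ} (h : EqOn f g V)
    (i : Fin n) (k : ℕ) : EqOn ((pderiv i)^[k] f) ((pderiv i)^[k] g) V := by
  induction k with
  | zero => exact h
  | succ k ih =>
    rw [Function.iterate_succ_apply', Function.iterate_succ_apply']
    exact pderiv_eqOn hV ih i

theorem iterate_pderiv_comm (hV : IsOpen V) {f : (Fin n → ℝ) → ℝ} (hf : ContDiffOn ℝ ∞ f V)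
    (i j : Fin n) (k : ℕ) :
    EqOn (pderiv j ((pderiv i)^[k] f)) ((pderiv i)^[k] (pderiv j f)) V := by
  induction k with
  | zero => exact fun _ _ => rfl
  | succ k ih =>
    rw [Function.iterate_succ_apply', Function.iterate_succ_apply']
    exact (pderiv_comm hV (contDiffOn_iterate_pderiv hV hf i k) j i).trans (pderiv_eqOn hV ih i)

theorem contDiffOn_listDeriv (hV : IsOpen V) {f : (Fin n → ℝ) → ℝ} (hf : ContDiffOn ℝ ∞ f V)
    (l : List (Fin n)) (α : Fin n → ℕ) : ContDiffOn ℝ ∞ (listDeriv l α f) V := by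
  induction l with
  | nil => exact hf
  | cons i l ih => exact contDiffOn_iterate_pderiv hV ih i _

theorem listDeriv_eqOn (hV : IsOpen V) {f g : (Fin n → ℝ) → ℝ} (h : EqOn f g V)
    (l : List (Fin n)) (α : Fin n → ℕ) : EqOn (listDeriv l α f) (listDeriv l α g) V := by
  induction l with
  | nil => exact h
  | cons i l ih => exact iterate_pderiv_eqOn hV ih i _

theorem pderiv_listDeriv (hV : IsOpen V) {f : (Fin n → ℝ) → ℝ} (hf : ContDiffOn ℝ ∞ f V)
    (l : List (Fin n)) (α : Fin n → ℕ) (j : Fin n) :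
    EqOn (pderiv j (listDeriv l α f)) (listDeriv l α (pderiv j f)) V := by
  induction l with
  | nil => exact fun _ _ => rfl
  | cons i l ih =>
    exact (iterate_pderiv_comm hV (contDiffOn_listDeriv hV hf l α) i j (α i)).trans
      (iterate_pderiv_eqOn hV ih i _)

theorem listDeriv_add_unit_of_notMem {l : List (Fin n)} {j : Fin n} (hj : j ∉ l)
    (α : Fin n → ℕ) (f : (Fin n → ℝ) → ℝ) : listDeriv l (α + unit j) f = listDeriv l α f := by
  induction l with
  | nil => rfl
  | cons i l ih =>
    rw [List.mem_cons, not_or] at hj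
    have : (α + unit j) i = α i := by simp [unit, Ne.symm hj.1]
    change (pderiv i)^[(α + unit j) i] (listDeriv l (α + unit j) f) = _
    rw [this, ih hj.2]
    rfl

/-- Without repetitions in the list, the extra derivative enters at exactly one place, and it
commutes past the derivatives applied after it. -/
theorem listDeriv_add_unit (hV : IsOpen V) {f : (Fin n → ℝ) → ℝ} (hf : ContDiffOn ℝ ∞ f V)
    {l : List (Fin n)} (hl : l.Nodup) (α : Fin n → ℕ) {j : Fin n} (hj : j ∈ l) :
    EqOn (listDeriv l (α + unit j) f) (pderiv j (listDeriv l α f)) V := by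
  induction l with
  | nil => simp at hj
  | cons i l ih =>
    rw [List.nodup_cons] at hl
    change EqOn ((pderiv i)^[(α + unit j) i] (listDeriv l (α + unit j) f))
      (pderiv j ((pderiv i)^[α i] (listDeriv l α f))) V
    by_cases hji : j = i
    · subst hji
      rw [listDeriv_add_unit_of_notMem hl.1]
      have : (α + unit j) j = α j + 1 := by simp [unit]
      rw [this, Function.iterate_succ_apply']
      exact fun _ _ => rfl
    · have : (α + unit j) i = α i := by simp [unit, Ne.symm hji]
      rw [this]
      have hjl : j ∈ l := by simpa [hji] using hj
      exact (iterate_pderiv_eqOn hV (ih hl.2 hjl) i _).trans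
        (iterate_pderiv_comm hV (contDiffOn_listDeriv hV hf l α) i j _).symm

theorem mderiv_zero (f : (Fin n → ℝ) → ℝ) : mderiv 0 f = f := by
  unfold mderiv
  induction List.finRange n with
  | nil => rfl
  | cons i l ih => simp

theorem contDiffOn_mderiv (hV : IsOpen V) {f : (Fin n → ℝ) → ℝ} (hf : ContDiffOn ℝ ∞ f V)
    (α : Fin n → ℕ) : ContDiffOn ℝ ∞ (mderiv α f) V :=
  contDiffOn_listDeriv hV hf _ α

theorem mderiv_eqOn (hV : IsOpen V) {f g : (Fin n → ℝ) → ℝ} (h : EqOn f g V)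
    (α : Fin n → ℕ) : EqOn (mderiv α f) (mderiv α g) V :=
  listDeriv_eqOn hV h _ α

theorem mderiv_add_unit (hV : IsOpen V) {f : (Fin n → ℝ) → ℝ} (hf : ContDiffOn ℝ ∞ f V)
    (α : Fin n → ℕ) (i : Fin n) : EqOn (mderiv (α + unit i) f) (pderiv i (mderiv α f)) V :=
  listDeriv_add_unit hV hf (List.nodup_finRange n) α (List.mem_finRange i)

theorem mderiv_add_unit' (hV : IsOpen V) {f : (Fin n → ℝ) → ℝ} (hf : ContDiffOn ℝ ∞ f V)
    (α : Fin n → ℕ) (i : Fin n) : EqOn (mderiv (α + unit i) f) (mderiv α (pderiv i f)) V :=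
  (mderiv_add_unit hV hf α i).trans (pderiv_listDeriv hV hf _ α i)

end Iterated

/-! ### Taylor coefficients -/

section TaylorCoeff

variable {V : Set (Fin n → ℝ)} {p : Fin n → ℝ}

theorem taylorCoeff_zero (f : (Fin n → ℝ) → ℝ) (p : Fin n → ℝ) : taylorCoeff f p 0 = f p := by
  simp [taylorCoeff, mderiv_zero, mfact_zero]

theorem taylorCoeff_congr (hV : IsOpen V) (hp : p ∈ V) {f g : (Fin n → ℝ) → ℝ}
    (h : EqOn f g V) (α : Fin n → ℕ) : taylorCoeff f p α = taylorCoeff g p α := by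
  rw [taylorCoeff, taylorCoeff, mderiv_eqOn hV h α hp]

/-- The factor `α i + 1` is the quotient of the two factorials. Together with the value at the zero
multi-index, this identity characterises the coefficients, so the algebraic rules below follow by
induction on `α` for all functions simultaneously. -/
theorem taylorCoeff_add_unit (hV : IsOpen V) (hp : p ∈ V) {f : (Fin n → ℝ) → ℝ}
    (hf : ContDiffOn ℝ ∞ f V) (α : Fin n → ℕ) (i : Fin n) :
    ((α i : ℝ) + 1) * taylorCoeff f p (α + unit i) = taylorCoeff (pderiv i f) p α := by
  have h1 : (mfact α : ℝ) ≠ 0 := by exact_mod_cast (mfact_pos α).ne'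
  have h2 : (α i : ℝ) + 1 ≠ 0 := by positivity
  rw [taylorCoeff, taylorCoeff, mderiv_add_unit' hV hf α i hp, mfact_add_unit]
  push_cast
  field_simp

theorem taylorCoeff_add (hV : IsOpen V) (hp : p ∈ V) {f g : (Fin n → ℝ) → ℝ}
    (hf : ContDiffOn ℝ ∞ f V) (hg : ContDiffOn ℝ ∞ g V) (α : Fin n → ℕ) :
    taylorCoeff (fun x => f x + g x) p α = taylorCoeff f p α + taylorCoeff g p α := by
  induction α using multiIndex_induction generalizing f g with
  | zero => simp [taylorCoeff_zero]
  | add_unit α i ih =>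
    have h2 : (α i : ℝ) + 1 ≠ 0 := by positivity
    apply mul_left_cancel₀ h2
    rw [mul_add, taylorCoeff_add_unit hV hp hf, taylorCoeff_add_unit hV hp hg,
      taylorCoeff_add_unit hV hp (hf.add hg), taylorCoeff_congr hV hp (pderiv_add hV hf hg i),
      ih (contDiffOn_pderiv hV hf i) (contDiffOn_pderiv hV hg i)]

theorem taylorCoeff_const_mul (hV : IsOpen V) (hp : p ∈ V) {f : (Fin n → ℝ) → ℝ}
    (hf : ContDiffOn ℝ ∞ f V) (c : ℝ) (α : Fin n → ℕ) :
    taylorCoeff (fun x => c * f x) p α = c * taylorCoeff f p α := by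
  induction α using multiIndex_induction generalizing f with
  | zero => simp [taylorCoeff_zero]
  | add_unit α i ih =>
    have h2 : (α i : ℝ) + 1 ≠ 0 := by positivity
    apply mul_left_cancel₀ h2
    rw [mul_left_comm, taylorCoeff_add_unit hV hp hf,
      taylorCoeff_add_unit hV hp (contDiffOn_const.mul hf),
      taylorCoeff_congr hV hp (pderiv_const_mul hV hf c i), ih (contDiffOn_pderiv hV hf i)]

theorem taylorCoeff_sum (hV : IsOpen V) (hp : p ∈ V) {ι : Type*} (s : Finset ι)
    {f : ι → (Fin n → ℝ) → ℝ} (hf : ∀ k, ContDiffOn ℝ ∞ (f k) V) (α : Fin n → ℕ) :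
    taylorCoeff (fun x => ∑ k ∈ s, f k x) p α = ∑ k ∈ s, taylorCoeff (f k) p α := by
  classical
  induction s using Finset.induction_on with
  | empty =>
    have := taylorCoeff_const_mul hV hp (contDiffOn_const (c := (0 : ℝ)) (s := V)) 0 α
    simpa using this
  | insert k s hk ih =>
    simp only [Finset.sum_insert hk]
    rw [taylorCoeff_add hV hp (hf k) (ContDiffOn.sum fun j _ => hf j), ih]

/-! ### Leibniz rule for products of three functions -/

/-- The triples of multi-indices with sum `β`. -/
def triples (β : Fin n → ℕ) : Finset ((Fin n → ℕ) × (Fin n → ℕ) × (Fin n → ℕ)) :=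
  (Finset.Iic β ×ˢ (Finset.Iic β ×ˢ Finset.Iic β)).filter (fun p => p.1 + p.2.1 + p.2.2 = β)

theorem mem_triples {β : Fin n → ℕ} {q : (Fin n → ℕ) × (Fin n → ℕ) × (Fin n → ℕ)} :
    q ∈ triples β ↔ q.1 + q.2.1 + q.2.2 = β := by
  simp only [triples, Finset.mem_filter, Finset.mem_product, Finset.mem_Iic, and_iff_right_iff_imp]
  intro h
  simp only [← h, Pi.le_def, Pi.add_apply]
  refine ⟨?_, ?_, ?_⟩ <;> intro k <;> omega

/-- Shift of the summation index. The triples on the right that are not reached have `q.1 i = 0`,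
and the weight removes them. -/
theorem sum_triples_fst (β : Fin n → ℕ) (i : Fin n)
    (X : (Fin n → ℕ) → (Fin n → ℕ) → (Fin n → ℕ) → ℝ) :
    ∑ q ∈ triples β, ((q.1 i : ℝ) + 1) * X (q.1 + unit i) q.2.1 q.2.2 =
      ∑ q ∈ triples (β + unit i), (q.1 i : ℝ) * X q.1 q.2.1 q.2.2 := by
  refine Finset.sum_bij_ne_zero (fun q _ _ => (q.1 + unit i, q.2.1, q.2.2)) ?_ ?_ ?_ ?_
  · intro q hq _
    rw [mem_triples] at hq ⊢
    simp only [← hq]; abel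
  · rintro ⟨a, b, c⟩ _ _ ⟨a', b', c'⟩ _ _ h
    simpa using h
  · rintro ⟨a, b, c⟩ hq h0
    obtain ⟨a, rfl⟩ := exists_eq_add_unit (α := a) (i := i) (by rintro h; simp [h] at h0)
    refine ⟨(a, b, c), ?_, ?_, rfl⟩
    · rw [mem_triples] at hq ⊢
      apply add_right_cancel (b := unit i)
      simp only [← hq]; abel
    · simpa [unit] using h0
  · intro q _ _; simp [unit]

theorem sum_triples_snd (β : Fin n → ℕ) (i : Fin n)
    (X : (Fin n → ℕ) → (Fin n → ℕ) → (Fin n → ℕ) → ℝ) :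
    ∑ q ∈ triples β, ((q.2.1 i : ℝ) + 1) * X q.1 (q.2.1 + unit i) q.2.2 =
      ∑ q ∈ triples (β + unit i), (q.2.1 i : ℝ) * X q.1 q.2.1 q.2.2 := by
  have key : ∀ (β : Fin n → ℕ) (Y : (Fin n → ℕ) → (Fin n → ℕ) → (Fin n → ℕ) → ℝ),
      ∑ q ∈ triples β, Y q.1 q.2.1 q.2.2 = ∑ q ∈ triples β, Y q.2.1 q.1 q.2.2 := by
    intro β Y
    refine Finset.sum_nbij' (fun q => (q.2.1, q.1, q.2.2)) (fun q => (q.2.1, q.1, q.2.2))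
      ?_ ?_ ?_ ?_ ?_ <;> intro q hq
    · rw [mem_triples] at hq ⊢
      simp only [← hq]; abel
    · rw [mem_triples] at hq ⊢
      simp only [← hq]; abel
    all_goals rfl
  rw [key β fun a b c => ((b i : ℝ) + 1) * X a (b + unit i) c,
    key _ fun a b c => (b i : ℝ) * X a b c]
  exact sum_triples_fst β i fun a b c => X b a c

theorem sum_triples_trd (β : Fin n → ℕ) (i : Fin n)
    (X : (Fin n → ℕ) → (Fin n → ℕ) → (Fin n → ℕ) → ℝ) :
    ∑ q ∈ triples β, ((q.2.2 i : ℝ) + 1) * X q.1 q.2.1 (q.2.2 + unit i) =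
      ∑ q ∈ triples (β + unit i), (q.2.2 i : ℝ) * X q.1 q.2.1 q.2.2 := by
  have key : ∀ (β : Fin n → ℕ) (Y : (Fin n → ℕ) → (Fin n → ℕ) → (Fin n → ℕ) → ℝ),
      ∑ q ∈ triples β, Y q.1 q.2.1 q.2.2 = ∑ q ∈ triples β, Y q.2.2 q.2.1 q.1 := by
    intro β Y
    refine Finset.sum_nbij' (fun q => (q.2.2, q.2.1, q.1)) (fun q => (q.2.2, q.2.1, q.1))
      ?_ ?_ ?_ ?_ ?_ <;> intro q hq
    · rw [mem_triples] at hq ⊢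
      simp only [← hq]; abel
    · rw [mem_triples] at hq ⊢
      simp only [← hq]; abel
    all_goals rfl
  rw [key β fun a b c => ((c i : ℝ) + 1) * X a b (c + unit i),
    key _ fun a b c => (c i : ℝ) * X a b c]
  exact sum_triples_fst β i fun a b c => X c b a

/-- The Leibniz rule for the Taylor coefficients of a product of three functions. -/
theorem taylorCoeff_mul_mul (hV : IsOpen V) (hp : p ∈ V) {f g h : (Fin n → ℝ) → ℝ}
    (hf : ContDiffOn ℝ ∞ f V) (hg : ContDiffOn ℝ ∞ g V) (hh : ContDiffOn ℝ ∞ h V)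
    (α : Fin n → ℕ) :
    taylorCoeff (fun x => f x * g x * h x) p α =
      ∑ q ∈ triples α, taylorCoeff f p q.1 * taylorCoeff g p q.2.1 * taylorCoeff h p q.2.2 := by
  induction α using multiIndex_induction generalizing f g h with
  | zero =>
    have : triples (0 : Fin n → ℕ) = {(0, 0, 0)} := by
      ext ⟨a, b, c⟩
      rw [mem_triples]
      simp [and_assoc]
    simp [this, taylorCoeff_zero]
  | add_unit α i ih =>
    have h2 : (α i : ℝ) + 1 ≠ 0 := by positivity
    apply mul_left_cancel₀ h2
    have e : EqOn (pderiv i (fun x => f x * g x * h x))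
        (fun x => (pderiv i f x * g x * h x + f x * pderiv i g x * h x) +
          f x * g x * pderiv i h x) V := by
      intro x hx
      rw [pderiv_mul hV (hf.mul hg) hh i hx]
      simp only
      rw [pderiv_mul hV hf hg i hx]
      ring
    have hf' := contDiffOn_pderiv hV hf i
    have hg' := contDiffOn_pderiv hV hg i
    have hh' := contDiffOn_pderiv hV hh i
    rw [taylorCoeff_add_unit hV hp ((hf.mul hg).mul hh), taylorCoeff_congr hV hp e,
      taylorCoeff_add hV hp (((hf'.mul hg).mul hh).add ((hf.mul hg').mul hh))
        ((hf.mul hg).mul hh'),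
      taylorCoeff_add hV hp ((hf'.mul hg).mul hh) ((hf.mul hg').mul hh),
      ih hf' hg hh, ih hf hg' hh, ih hf hg hh']
    have e1 := sum_triples_fst α i fun a b c =>
      taylorCoeff f p a * taylorCoeff g p b * taylorCoeff h p c
    have e2 := sum_triples_snd α i fun a b c =>
      taylorCoeff f p a * taylorCoeff g p b * taylorCoeff h p c
    have e3 := sum_triples_trd α i fun a b c =>
      taylorCoeff f p a * taylorCoeff g p b * taylorCoeff h p c
    -- The weight `α i + 1` is the sum of the `i`-th entries of the three indices. This splits the
    -- sum into the three terms of the product rule.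
    have e4 : ((α i : ℝ) + 1) * ∑ q ∈ triples (α + unit i),
          taylorCoeff f p q.1 * taylorCoeff g p q.2.1 * taylorCoeff h p q.2.2 =
        ∑ q ∈ triples (α + unit i), ((q.1 i : ℝ) *
          (taylorCoeff f p q.1 * taylorCoeff g p q.2.1 * taylorCoeff h p q.2.2) +
          (q.2.1 i : ℝ) *
          (taylorCoeff f p q.1 * taylorCoeff g p q.2.1 * taylorCoeff h p q.2.2) +
          (q.2.2 i : ℝ) *
          (taylorCoeff f p q.1 * taylorCoeff g p q.2.1 * taylorCoeff h p q.2.2)) := by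
      rw [Finset.mul_sum]
      refine Finset.sum_congr rfl fun q hq => ?_
      rw [mem_triples] at hq
      have : ((q.1 i : ℝ) + q.2.1 i + q.2.2 i) = (α i : ℝ) + 1 := by
        have := congrFun hq i
        simp only [Pi.add_apply, unit, Pi.single_eq_same] at this
        exact_mod_cast this
      rw [← this]; ring
    rw [e4, Finset.sum_add_distrib, Finset.sum_add_distrib, ← e1, ← e2, ← e3]
    simp only [← taylorCoeff_add_unit hV hp hf, ← taylorCoeff_add_unit hV hp hg,
      ← taylorCoeff_add_unit hV hp hh]
    congr 1
    · congr 1 <;> refine Finset.sum_congr rfl fun q _ => by ring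
    · refine Finset.sum_congr rfl fun q _ => by ring

end TaylorCoeff

/-! ### Taylor's formula along a segment -/

section Taylor

variable {V : Set (Fin n → ℝ)} {f : (Fin n → ℝ) → ℝ}

theorem mem_piAntidiag_univ {k : ℕ} {γ : Fin n → ℕ} :
    γ ∈ Finset.piAntidiag (Finset.univ : Finset (Fin n)) k ↔ deg γ = k := by
  simp [deg]

/-- Each `δ` arises from `δ - 1_i` with weight `δ i`, and these weights add up to `k + 1`. -/
theorem sum_piAntidiag_add_unit (k : ℕ) (Y : (Fin n → ℕ) → ℝ) :
    ∑ γ ∈ Finset.piAntidiag (Finset.univ : Finset (Fin n)) k,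
        ∑ i, ((γ i : ℝ) + 1) * Y (γ + unit i) =
      (k + 1) * ∑ δ ∈ Finset.piAntidiag (Finset.univ : Finset (Fin n)) (k + 1), Y δ := by
  have key : ∀ i : Fin n,
      ∑ γ ∈ Finset.piAntidiag (Finset.univ : Finset (Fin n)) k,
        ((γ i : ℝ) + 1) * Y (γ + unit i) =
      ∑ δ ∈ Finset.piAntidiag (Finset.univ : Finset (Fin n)) (k + 1), (δ i : ℝ) * Y δ := by
    intro i
    refine Finset.sum_bij_ne_zero (fun γ _ _ => γ + unit i) ?_ ?_ ?_ ?_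
    · intro γ hγ _
      rw [mem_piAntidiag_univ] at hγ ⊢
      rw [deg_add, hγ, deg_unit]
    · intro γ _ _ γ' _ _ h
      simpa using h
    · intro δ hδ h0
      obtain ⟨γ, rfl⟩ := exists_eq_add_unit (α := δ) (i := i) (by rintro h; simp [h] at h0)
      refine ⟨γ, ?_, ?_, rfl⟩
      · rw [mem_piAntidiag_univ, deg_add, deg_unit] at hδ
        rw [mem_piAntidiag_univ]
        omega
      · simpa [unit] using h0
    · intro γ _ _; simp [unit]
  rw [Finset.sum_comm, Finset.sum_congr rfl fun i _ => key i, Finset.sum_comm, Finset.mul_sum]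
  refine Finset.sum_congr rfl fun δ hδ => ?_
  rw [mem_piAntidiag_univ] at hδ
  rw [← Finset.sum_mul]
  congr 1
  unfold deg at hδ
  exact_mod_cast hδ

/-- The homogeneous part of order `k` in the expansion of `f` in direction `h`. -/
noncomputable def taylorTerm (f : (Fin n → ℝ) → ℝ) (y h : Fin n → ℝ) (k : ℕ) (t : ℝ) : ℝ :=
  ∑ γ ∈ Finset.piAntidiag (Finset.univ : Finset (Fin n)) k,
    mpow h γ / (mfact γ : ℝ) * mderiv γ f (y + t • h)

theorem taylorTerm_zero (f : (Fin n → ℝ) → ℝ) (y h : Fin n → ℝ) (t : ℝ) :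
    taylorTerm f y h 0 t = f (y + t • h) := by
  have : Finset.piAntidiag (Finset.univ : Finset (Fin n)) 0 = {0} := by
    ext γ
    rw [mem_piAntidiag_univ, deg_eq_zero, Finset.mem_singleton]
  simp [taylorTerm, this, mderiv_zero, mfact_zero, mpow]

/-- Differentiation along the line applies `∑ h_i ∂_i`. The factorial weights then combine to `k +
1`, so the homogeneous parts form a chain under differentiation. -/
theorem hasDerivAt_taylorTerm (hV : IsOpen V) (hf : ContDiffOn ℝ ∞ f V) {y h : Fin n → ℝ}
    {t : ℝ} (ht : y + t • h ∈ V) (k : ℕ) :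
    HasDerivAt (taylorTerm f y h k) ((k + 1) * taylorTerm f y h (k + 1) t) t := by
  have h1 : HasDerivAt (taylorTerm f y h k)
      (∑ γ ∈ Finset.piAntidiag (Finset.univ : Finset (Fin n)) k,
        mpow h γ / (mfact γ : ℝ) * ∑ i, h i * pderiv i (mderiv γ f) (y + t • h)) t := by
    unfold taylorTerm
    exact HasDerivAt.fun_sum fun γ _ => (hasDerivAt_comp_line
      (differentiableAt_of_contDiffOn hV (contDiffOn_mderiv hV hf γ) ht)).const_mul _
  convert h1 using 1
  rw [taylorTerm, ← sum_piAntidiag_add_unit k fun δ =>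
    mpow h δ / (mfact δ : ℝ) * mderiv δ f (y + t • h)]
  refine Finset.sum_congr rfl fun γ _ => ?_
  rw [Finset.mul_sum]
  refine Finset.sum_congr rfl fun i _ => ?_
  rw [mderiv_add_unit hV hf γ i ht, mpow_add_unit, mfact_add_unit]
  have h1 : (mfact γ : ℝ) ≠ 0 := by exact_mod_cast (mfact_pos γ).ne'
  have h2 : (γ i : ℝ) + 1 ≠ 0 := by positivity
  push_cast
  field_simp

theorem isOpen_preimage_line (hV : IsOpen V) (y h : Fin n → ℝ) :
    IsOpen {t : ℝ | y + t • h ∈ V} :=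
  hV.preimage (by fun_prop)

theorem taylorTerm_one (hV : IsOpen V) (hf : ContDiffOn ℝ ∞ f V) {y h : Fin n → ℝ}
    {t : ℝ} (ht : y + t • h ∈ V) :
    taylorTerm f y h 1 t = ∑ i, h i * pderiv i f (y + t • h) := by
  have h1 := hasDerivAt_taylorTerm hV hf ht 0
  have h2 := hasDerivAt_comp_line (h := h) (differentiableAt_of_contDiffOn hV hf ht)
  rw [show taylorTerm f y h 0 = fun s => f (y + s • h) from funext (taylorTerm_zero f y h)] at h1
  simpa using h1.unique h2

theorem hasDerivAt_taylorTerm_one (hV : IsOpen V) (hf : ContDiffOn ℝ ∞ f V) {y h : Fin n → ℝ}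
    {t : ℝ} (ht : y + t • h ∈ V) :
    HasDerivAt (taylorTerm f y h 1)
      (∑ i, ∑ j, h i * h j * pderiv j (pderiv i f) (y + t • h)) t := by
  have h1 : HasDerivAt (fun s : ℝ => ∑ i, h i * pderiv i f (y + s • h))
      (∑ i, h i * ∑ j, h j * pderiv j (pderiv i f) (y + t • h)) t :=
    HasDerivAt.fun_sum fun i _ => (hasDerivAt_comp_line
      (differentiableAt_of_contDiffOn hV (contDiffOn_pderiv hV hf i) ht)).const_mul _
  have h2 : taylorTerm f y h 1 =ᶠ[𝓝 t] fun s : ℝ => ∑ i, h i * pderiv i f (y + s • h) := by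
    filter_upwards [(isOpen_preimage_line hV y h).mem_nhds ht] with s hs
    exact taylorTerm_one hV hf hs
  refine (h1.congr_of_eventuallyEq h2).congr_deriv ?_
  simp only [Finset.mul_sum, mul_assoc]

theorem taylorTerm_two (hV : IsOpen V) (hf : ContDiffOn ℝ ∞ f V) {y h : Fin n → ℝ}
    {t : ℝ} (ht : y + t • h ∈ V) :
    2 * taylorTerm f y h 2 t = ∑ i, ∑ j, h i * h j * pderiv j (pderiv i f) (y + t • h) := by
  have := (hasDerivAt_taylorTerm hV hf ht 1).unique (hasDerivAt_taylorTerm_one hV hf ht)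
  norm_num at this
  exact this

theorem continuousOn_mderiv_line (hV : IsOpen V) (hf : ContDiffOn ℝ ∞ f V) {y h : Fin n → ℝ}
    (hseg : ∀ t ∈ Icc (0 : ℝ) 1, y + t • h ∈ V) (γ : Fin n → ℕ) :
    ContinuousOn (fun t : ℝ => mderiv γ f (y + t • h)) (uIcc 0 1) := by
  rw [uIcc_of_le zero_le_one]
  exact (contDiffOn_mderiv hV hf γ).continuousOn.comp (by fun_prop) hseg

/-- Taylor's formula of order `M` with integral remainder. -/
theorem taylor_formula (hV : IsOpen V) (hf : ContDiffOn ℝ ∞ f V) {y h : Fin n → ℝ}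
    (hseg : ∀ t ∈ Icc (0 : ℝ) 1, y + t • h ∈ V) {M : ℕ} (hM : 1 ≤ M) :
    f (y + h) = ∑ k ∈ Finset.range M, taylorTerm f y h k 0 +
      (M : ℝ) * ∑ γ ∈ Finset.piAntidiag (Finset.univ : Finset (Fin n)) M,
        ∫ t in (0 : ℝ)..1, (1 - t) ^ (M - 1) * (mpow h γ / (mfact γ : ℝ)) *
          mderiv γ f (y + t • h) := by
  have hcont : ∀ γ : Fin n → ℕ, ContinuousOn (fun t : ℝ => (1 - t) ^ (M - 1) *
      (mpow h γ / (mfact γ : ℝ)) * mderiv γ f (y + t • h)) (uIcc 0 1) := fun γ =>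
    ContinuousOn.mul (by fun_prop) (continuousOn_mderiv_line hV hf hseg γ)
  -- The sum is the Taylor polynomial based at `y + s • h` and evaluated at `y + h`. Its derivative
  -- in the base point telescopes to the last term. At `s = 0` it is the expansion at `y`, at `s =
  -- 1` it is `f (y + h)`.
  have hder : ∀ N : ℕ, ∀ t ∈ uIcc (0 : ℝ) 1,
      HasDerivAt (fun s => ∑ k ∈ Finset.range (N + 1), (1 - s) ^ k * taylorTerm f y h k s)
        ((N + 1) * ((1 - t) ^ N * taylorTerm f y h (N + 1) t)) t := by
    intro N t ht
    rw [uIcc_of_le zero_le_one] at ht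
    induction N with
    | zero =>
      simpa using hasDerivAt_taylorTerm hV hf (hseg t ht) 0
    | succ N ih =>
      simp only [Finset.sum_range_succ _ (N + 1)]
      have h1 : HasDerivAt (fun s : ℝ => (1 - s) ^ (N + 1))
          (((N + 1 : ℕ) : ℝ) * (1 - t) ^ N * (-1)) t :=
        ((hasDerivAt_id t).const_sub 1).pow (N + 1)
      refine (ih.add (h1.mul (hasDerivAt_taylorTerm hV hf (hseg t ht) (N + 1)))).congr_deriv ?_
      push_cast
      ring
  obtain ⟨N, rfl⟩ : ∃ N, M = N + 1 := ⟨M - 1, by omega⟩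
  have hsum : ∀ t : ℝ, ((N : ℝ) + 1) * ((1 - t) ^ N * taylorTerm f y h (N + 1) t) =
      ((N : ℝ) + 1) * ∑ γ ∈ Finset.piAntidiag (Finset.univ : Finset (Fin n)) (N + 1),
        (1 - t) ^ (N + 1 - 1) * (mpow h γ / (mfact γ : ℝ)) * mderiv γ f (y + t • h) := by
    intro t
    rw [taylorTerm, Finset.mul_sum]
    simp [mul_assoc]
  have hcont' : ContinuousOn
      (fun t : ℝ => ((N : ℝ) + 1) * ((1 - t) ^ N * taylorTerm f y h (N + 1) t)) (uIcc 0 1) := by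
    simp only [hsum]
    exact continuousOn_const.mul (continuousOn_finsetSum _ fun γ _ => hcont γ)
  have hint := intervalIntegral.integral_eq_sub_of_hasDerivAt (hder N) hcont'.intervalIntegrable
  simp only [hsum] at hint
  rw [intervalIntegral.integral_const_mul, intervalIntegral.integral_finsetSum
    fun γ _ => (hcont γ).intervalIntegrable] at hint
  rw [Nat.cast_add, Nat.cast_one, hint]
  have h1 : ∑ k ∈ Finset.range (N + 1), (1 - (1 : ℝ)) ^ k * taylorTerm f y h k 1 = f (y + h) := by
    rw [Finset.sum_range_succ']
    simp [taylorTerm_zero]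
  rw [h1]
  simp

end Taylor

/-! ### The comparison principle -/

section Comparison

/-- The bilinear form of a matrix. -/
def bilin (A : Matrix (Fin n) (Fin n) ℝ) (u v : Fin n → ℝ) : ℝ :=
  ∑ i, ∑ j, A i j * u i * v j

/-- The vector of partial derivatives. -/
noncomputable def grad (f : (Fin n → ℝ) → ℝ) (z : Fin n → ℝ) : Fin n → ℝ :=
  fun i => pderiv i f z

theorem bilin_eq (A : Matrix (Fin n) (Fin n) ℝ) (u v : Fin n → ℝ) :
    bilin A u v = u ⬝ᵥ (A *ᵥ v) := by
  simp only [bilin, dotProduct, Matrix.mulVec, Finset.mul_sum]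
  refine Finset.sum_congr rfl fun i _ => Finset.sum_congr rfl fun j _ => by ring

theorem bilin_symm {A : Matrix (Fin n) (Fin n) ℝ} (hA : A.IsHermitian) (u v : Fin n → ℝ) :
    bilin A u v = bilin A v u := by
  unfold bilin
  rw [Finset.sum_comm]
  refine Finset.sum_congr rfl fun i _ => Finset.sum_congr rfl fun j _ => ?_
  have : A j i = A i j := by simpa using hA.apply i j
  rw [this]; ring

theorem bilin_self_nonneg {A : Matrix (Fin n) (Fin n) ℝ} (hA : A.PosSemidef) (u : Fin n → ℝ) :
    0 ≤ bilin A u u := by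
  rw [bilin_eq]
  simpa using hA.dotProduct_mulVec_nonneg u

theorem eq_zero_of_bilin_self_eq_zero {A : Matrix (Fin n) (Fin n) ℝ} (hA : A.PosDef)
    {u : Fin n → ℝ} (h : bilin A u u = 0) : u = 0 := by
  by_contra hu
  have := hA.dotProduct_mulVec_pos hu
  rw [bilin_eq] at h
  simp [h] at this

/-- Cauchy–Schwarz, read off from the nonnegativity of the form at `b • u - a • v`. -/
theorem bilin_le_of_self_le {A : Matrix (Fin n) (Fin n) ℝ} (hA : A.PosSemidef)
    {u v : Fin n → ℝ} {a b : ℝ} (ha : 0 < a) (hb : 0 < b) (hu : bilin A u u ≤ a ^ 2)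
    (hv : bilin A v v ≤ b ^ 2) : bilin A u v ≤ a * b := by
  have h := bilin_self_nonneg hA (b • u - a • v)
  have e : bilin A (b • u - a • v) (b • u - a • v) =
      b ^ 2 * bilin A u u - 2 * (a * b) * bilin A u v + a ^ 2 * bilin A v v := by
    have h1 : bilin A (b • u - a • v) (b • u - a • v) =
      b ^ 2 * bilin A u u - a * b * bilin A u v - a * b * bilin A v u + a ^ 2 * bilin A v v := by
      simp only [bilin, Finset.mul_sum, ← Finset.sum_sub_distrib, ← Finset.sum_add_distrib]
      refine Finset.sum_congr rfl fun i _ => Finset.sum_congr rfl fun j _ => ?_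
      simp only [Pi.sub_apply, Pi.smul_apply, smul_eq_mul]
      ring
    rw [h1, bilin_symm hA.1 v u]
    ring
  rw [e] at h
  have h1 : b ^ 2 * bilin A u u ≤ b ^ 2 * a ^ 2 := by gcongr
  have h2 : a ^ 2 * bilin A v v ≤ a ^ 2 * b ^ 2 := by gcongr
  have hab : 0 < a * b := by positivity
  nlinarith

theorem eventually_lt_of_hasDerivAt_pos {φ : ℝ → ℝ} {d : ℝ} (h : HasDerivAt φ d 0) (hd : 0 < d) :
    ∀ᶠ t in 𝓝[>] (0 : ℝ), φ 0 < φ t := by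
  have h1 := (hasDerivAt_iff_tendsto_slope.1 h).mono_left
    (nhdsWithin_mono (0 : ℝ) fun t (ht : 0 < t) => ht.ne')
  filter_upwards [h1.eventually (lt_mem_nhds hd), self_mem_nhdsWithin] with t ht ht'
  rw [slope_def_field, sub_zero] at ht
  have := (div_pos_iff_of_pos_right ht').1 ht
  linarith

theorem tendsto_line (p v : Fin n → ℝ) : Tendsto (fun t : ℝ => p + t • v) (𝓝 0) (𝓝 p) := by
  have hc : ContinuousAt (fun t : ℝ => p + t • v) 0 := by fun_prop
  simpa [ContinuousAt] using hc

/-- A subsolution of the eikonal equation is dominated by a solution on its compact sublevel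
sets. -/
theorem le_of_eikonal {K : Set (Fin n → ℝ)} (hK : IsCompact K) {p x : Fin n → ℝ}
    {A : (Fin n → ℝ) → Matrix (Fin n) (Fin n) ℝ} {F G : (Fin n → ℝ) → ℝ} {s : ℝ}
    (hA : ∀ z ∈ K, (A z).PosSemidef)
    (hFd : ∀ z ∈ K, DifferentiableAt ℝ F z) (hGd : ∀ z ∈ K, DifferentiableAt ℝ G z)
    (hF : ∀ z ∈ K, 1 / 4 * bilin (A z) (grad F z) (grad F z) ≤ F z)
    (hG : ∀ z ∈ K, G z = 1 / 4 * bilin (A z) (grad G z) (grad G z))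
    (hFp : F p = 0) (hFpos : ∀ z ∈ K, z ≠ p → 0 < F z) (hGpos : ∀ z ∈ K, z ≠ p → 0 < G z)
    (hint : ∀ z ∈ K, G z ≤ s → K ∈ 𝓝 z) (hx : x ∈ K) (hxs : G x ≤ s) : F x ≤ G x := by
  have hFc : ContinuousOn F K := fun z hz => (hFd z hz).continuousAt.continuousWithinAt
  have hGc : ContinuousOn G K := fun z hz => (hGd z hz).continuousAt.continuousWithinAt
  have hG0 : ∀ z ∈ K, 0 ≤ G z := fun z hz => by
    rw [hG z hz]
    have := bilin_self_nonneg (hA z hz) (grad G z)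
    positivity
  -- The factor `c < 1` creates a strict inequality at an interior maximum. If `√(F x)` exceeded
  -- `√(G x)`, the chosen `c` would make `c * √(F x)` their mean, which is larger than `√(G x)`.
  suffices key : ∀ c : ℝ, 0 < c → c < 1 → c * √(F x) ≤ √(G x) by
    by_contra! hlt
    have h1 : √(G x) < √(F x) := Real.sqrt_lt_sqrt (hG0 x hx) hlt
    have h0 := Real.sqrt_nonneg (G x)
    have hpos : 0 < √(F x) := h0.trans_lt h1
    have := key ((√(G x) + √(F x)) / (2 * √(F x))) (by positivity)
      (by rw [div_lt_one (by positivity)]; linarith)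
    rw [div_mul_eq_mul_div, mul_comm 2, ← div_div, mul_div_assoc, mul_div_assoc,
      mul_comm, div_self hpos.ne'] at this
    linarith
  intro c hc0 hc1
  set R := {z ∈ K | G z ≤ s} with hR
  have hRc : IsCompact R := by
    have : R = K ∩ G ⁻¹' Iic s := rfl
    exact hK.of_isClosed_subset (this ▸ hGc.preimage_isClosed_of_isClosed hK.isClosed isClosed_Iic)
      (fun z hz => hz.1)
  have hcont : ContinuousOn (fun z => c * √(F z) - √(G z)) R :=
    ((hFc.sqrt.const_smul c).sub hGc.sqrt).mono fun z hz => hz.1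
  obtain ⟨z, ⟨hzK, hzs⟩, hmax⟩ := hRc.exists_isMaxOn ⟨x, hx, hxs⟩ hcont
  have hmaxx := hmax (show x ∈ R from ⟨hx, hxs⟩)
  simp only [mem_ofPred_eq] at hmaxx
  -- At the source the maximal value is `-√(G p) ≤ 0`, which is the claim. A maximum elsewhere is
  -- impossible.
  by_cases hzp : z = p
  · rw [hzp, hFp] at hmaxx
    have := Real.sqrt_nonneg (G p)
    simp at hmaxx
    linarith
  exfalso
  have hFz := hFpos z hzK hzp
  have hGz := hGpos z hzK hzp
  -- Direction of descent `-A∇G`. Along it `√G` has derivative `-2√G`, while that of `√F` is at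
  -- least `-2√G` by Cauchy–Schwarz. Hence `c√F - √G` grows at rate at least `2(1 - c)√G > 0`.
  set w : Fin n → ℝ := fun j => -∑ i, A z i j * grad G z i with hw
  have hz0 : z + (0 : ℝ) • w = z := by simp
  have hwsum : ∀ f : (Fin n → ℝ) → ℝ,
      ∑ j, w j * pderiv j f z = -bilin (A z) (grad G z) (grad f z) := by
    intro f
    rw [bilin, Finset.sum_comm, ← Finset.sum_neg_distrib]
    refine Finset.sum_congr rfl fun j _ => ?_
    rw [hw]
    simp only [neg_mul, Finset.sum_mul, grad]
  have hdF : HasDerivAt (fun t : ℝ => F (z + t • w)) (-bilin (A z) (grad G z) (grad F z)) 0 := by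
    rw [← hwsum]
    simpa using hasDerivAt_comp_line (h := w) (t := 0) (y := z) (by rw [hz0]; exact hFd z hzK)
  have hdG : HasDerivAt (fun t : ℝ => G (z + t • w)) (-(4 * G z)) 0 := by
    have h4 : 4 * G z = bilin (A z) (grad G z) (grad G z) := by rw [hG z hzK]; ring
    rw [h4, ← hwsum]
    simpa using hasDerivAt_comp_line (h := w) (t := 0) (y := z) (by rw [hz0]; exact hGd z hzK)
  have hsF : 0 < √(F z) := Real.sqrt_pos.2 hFz
  have hsG : 0 < √(G z) := Real.sqrt_pos.2 hGz
  have hdh := ((hdF.sqrt (by rw [hz0]; exact hFz.ne')).const_mul c).sub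
    (hdG.sqrt (by rw [hz0]; exact hGz.ne'))
  rw [hz0] at hdh
  have hcs : bilin (A z) (grad G z) (grad F z) ≤ (2 * √(G z)) * (2 * √(F z)) := by
    apply bilin_le_of_self_le (hA z hzK) (by positivity) (by positivity)
    · rw [mul_pow, Real.sq_sqrt hGz.le]
      linarith [hG z hzK]
    · rw [mul_pow, Real.sq_sqrt hFz.le]
      linarith [hF z hzK]
  have hpos : 0 < c * (-bilin (A z) (grad G z) (grad F z) / (2 * √(F z))) -
      -(4 * G z) / (2 * √(G z)) := by
    have e1 : -(4 * G z) / (2 * √(G z)) = -(2 * √(G z)) := by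
      rw [div_eq_iff (by positivity)]
      nlinarith [Real.mul_self_sqrt hGz.le]
    have e2 : -(2 * √(G z)) ≤ -bilin (A z) (grad G z) (grad F z) / (2 * √(F z)) := by
      rw [le_div_iff₀ (by positivity)]
      linarith
    have e3 : c * -(2 * √(G z)) ≤
      c * (-bilin (A z) (grad G z) (grad F z) / (2 * √(F z))) := by gcongr
    rw [e1]
    nlinarith
  have hev1 := eventually_lt_of_hasDerivAt_pos hdh hpos
  -- `G` decreases along `w`, so the moved point stays in the sublevel set and contradicts
  -- maximality.
  have hev2 := eventually_lt_of_hasDerivAt_pos hdG.neg (by linarith)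
  have hev3 : ∀ᶠ t in 𝓝[>] (0 : ℝ), z + t • w ∈ K := by
    exact nhdsWithin_le_nhds ((tendsto_line z w).eventually (hint z hzK hzs))
  obtain ⟨t, ht1, ht2, ht3⟩ := (hev1.and (hev2.and hev3)).exists
  simp only [Pi.neg_apply, Pi.sub_apply, hz0] at ht1 ht2
  have := hmax (show z + t • w ∈ R from ⟨ht3, by linarith⟩)
  simp only [mem_ofPred_eq] at this
  linarith

end Comparison

/-! ### Solutions of the eikonal equation near a point -/

/-- The Hessian matrix. -/
noncomputable def hessian (f : (Fin n → ℝ) → ℝ) (p : Fin n → ℝ) : Matrix (Fin n) (Fin n) ℝ :=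
  Matrix.of fun i j => pderiv i (pderiv j f) p

/-- `f` is a smooth solution on `V` of the eikonal equation with source `p`. -/
structure IsLocalSolution (A : (Fin n → ℝ) → Matrix (Fin n) (Fin n) ℝ) (V : Set (Fin n → ℝ))
    (p : Fin n → ℝ) (f : (Fin n → ℝ) → ℝ) : Prop where
  isOpen : IsOpen V
  mem : p ∈ V
  smooth_coeff : ∀ i j, ContDiffOn ℝ ∞ (fun x => A x i j) V
  posDef : ∀ x ∈ V, (A x).PosDef
  smooth : ContDiffOn ℝ ∞ f V
  eikonal : ∀ x ∈ V, f x = 1 / 4 * bilin (A x) (grad f x) (grad f x)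
  boundary : ∀ x ∈ V, f x = 0 ↔ x = p

namespace IsLocalSolution

variable {A : (Fin n → ℝ) → Matrix (Fin n) (Fin n) ℝ} {V : Set (Fin n → ℝ)}
  {p : Fin n → ℝ} {f : (Fin n → ℝ) → ℝ}

theorem apply_source (h : IsLocalSolution A V p f) : f p = 0 := (h.boundary p h.mem).2 rfl

theorem pos (h : IsLocalSolution A V p f) {x : Fin n → ℝ} (hx : x ∈ V) (hxp : x ≠ p) :
    0 < f x := by
  refine lt_of_le_of_ne ?_ fun h0 => hxp ((h.boundary x hx).1 h0.symm)
  rw [h.eikonal x hx]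
  have := bilin_self_nonneg (h.posDef x hx).posSemidef (grad f x)
  positivity

theorem pderiv_source (h : IsLocalSolution A V p f) (i : Fin n) : pderiv i f p = 0 := by
  have h1 := h.eikonal p h.mem
  rw [h.apply_source] at h1
  exact congrFun (eq_zero_of_bilin_self_eq_zero (h.posDef p h.mem) (u := grad f p)
    (by linarith)) i

/-- Two solutions are comparable on small sublevel sets. -/
theorem le_of_sphere {q : Fin n → ℝ} {r s : ℝ} {F : (Fin n → ℝ) → ℝ}
    (h : IsLocalSolution A V p f) (hr : Metric.closedBall q r ⊆ V)
    (hFd : ∀ z ∈ Metric.closedBall q r, DifferentiableAt ℝ F z)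
    (hF : ∀ z ∈ Metric.closedBall q r, 1 / 4 * bilin (A z) (grad F z) (grad F z) ≤ F z)
    (hFp : F p = 0) (hFpos : ∀ z ∈ Metric.closedBall q r, z ≠ p → 0 < F z)
    (hs : ∀ z ∈ Metric.sphere q r, s < f z) {x : Fin n → ℝ} (hx : x ∈ Metric.closedBall q r)
    (hxs : f x ≤ s) : F x ≤ f x := by
  refine le_of_eikonal (isCompact_closedBall q r) (fun z hz => (h.posDef z (hr hz)).posSemidef)
    hFd (fun z hz => differentiableAt_of_contDiffOn h.isOpen h.smooth (hr hz)) hF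
    (fun z hz => h.eikonal z (hr hz)) hFp hFpos (fun z hz => h.pos (hr hz)) ?_ hx hxs
  intro z hz hzs
  -- The solution exceeds `s` on the sphere, so its sublevel set lies in the open ball.
  have hlt : dist z q < r := by
    refine lt_of_le_of_ne hz fun heq => ?_
    exact absurd (hs z heq) (not_lt.2 hzs)
  exact Filter.mem_of_superset (Metric.isOpen_ball.mem_nhds hlt) Metric.ball_subset_closedBall

/-- A solution grows quadratically at the source. -/
theorem exists_quadratic_lower_bound (h : IsLocalSolution A V p f) :
    ∃ c > 0, ∀ᶠ x in 𝓝 p, c * ∑ i, (x i - p i) ^ 2 ≤ f x := by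
  obtain ⟨B, hB0, hB⟩ : ∃ B > 0, ∀ᶠ x in 𝓝 p, ∀ i j, |A x i j| < B := by
    refine ⟨∑ i, ∑ j, |A p i j| + 1, by positivity, ?_⟩
    rw [eventually_all]
    intro i
    rw [eventually_all]
    intro j
    have hc : ContinuousAt (fun x => |A x i j|) p :=
      ((h.smooth_coeff i j).continuousOn.continuousAt (h.isOpen.mem_nhds h.mem)).abs
    refine hc.eventually (gt_mem_nhds ?_)
    have h1 : |A p i j| ≤ ∑ j, |A p i j| :=
      Finset.single_le_sum (f := fun j => |A p i j|) (fun j _ => abs_nonneg _) (Finset.mem_univ j)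
    have h2 : ∑ j, |A p i j| ≤ ∑ i, ∑ j, |A p i j| :=
      Finset.single_le_sum (f := fun i => ∑ j, |A p i j|)
        (fun i _ => Finset.sum_nonneg fun j _ => abs_nonneg _) (Finset.mem_univ i)
    linarith
  obtain ⟨r, hr0, hr⟩ := Metric.nhds_basis_closedBall.mem_iff.1
    (Filter.inter_mem hB (h.isOpen.mem_nhds h.mem))
  have hrV : Metric.closedBall p r ⊆ V := fun z hz => (hr hz).2
  have hrB : ∀ z ∈ Metric.closedBall p r, ∀ i j, |A z i j| < B := fun z hz => (hr hz).1
  obtain ⟨m, hm0, hm⟩ := (isCompact_sphere p r).exists_forall_le' (a := 0)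
    (h.smooth.continuousOn.mono (Metric.sphere_subset_closedBall.trans hrV))
    (fun z hz => h.pos (hrV (Metric.sphere_subset_closedBall hz))
      (by rintro rfl; simp at hz; linarith))
  -- For `F = c|x - p|²` the left side of the subsolution inequality is `c²⟨A(x - p), x - p⟩ ≤ c² n
  -- B |x - p|²`. This is at most `F` because `c n B ≤ 1`.
  set c : ℝ := 1 / (n * B + 1) with hc
  have hc0 : 0 < c := by positivity
  have hder : ∀ z : Fin n → ℝ, HasFDerivAt (fun x : Fin n → ℝ => c * ∑ i, (x i - p i) ^ 2)
      (c • ∑ i, (2 * (z i - p i)) • ContinuousLinearMap.proj (R := ℝ) (φ := fun _ : Fin n => ℝ) i)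
      z := by
    intro z
    refine HasFDerivAt.const_mul (HasFDerivAt.fun_sum fun i _ => ?_) c
    have h1 : HasFDerivAt (fun x : Fin n → ℝ => x i - p i)
      (ContinuousLinearMap.proj (R := ℝ) (φ := fun _ : Fin n => ℝ) i) z :=
      (hasFDerivAt_apply i z).sub_const (p i)
    simpa using h1.pow 2
  have hgrad : ∀ z : Fin n → ℝ, grad (fun x : Fin n → ℝ => c * ∑ i, (x i - p i) ^ 2) z =
      fun i => 2 * c * (z i - p i) := by
    intro z
    ext i
    simp only [grad, pderiv, (hder z).fderiv]
    simp [Pi.single_apply]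
    ring
  refine ⟨c, hc0, ?_⟩
  have hcf : ContinuousAt f p := h.smooth.continuousOn.continuousAt (h.isOpen.mem_nhds h.mem)
  filter_upwards [Metric.closedBall_mem_nhds p hr0,
    hcf.eventually (gt_mem_nhds (show f p < m / 2 by rw [h.apply_source]; linarith))]
    with x hx hxm
  refine h.le_of_sphere (F := fun x : Fin n → ℝ => c * ∑ i, (x i - p i) ^ 2) hrV
    (fun z _ => (hder z).differentiableAt) ?_ (by simp) ?_
    (s := m / 2) (fun z hz => by linarith [hm z hz]) hx hxm.le
  · intro z hz
    rw [hgrad]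
    have hterm : ∀ i j : Fin n, A z i j * (z i - p i) * (z j - p j) ≤
        B * (((z i - p i) ^ 2 + (z j - p j) ^ 2) / 2) := by
      intro i j
      have h1 : A z i j * (z i - p i) * (z j - p j) ≤ |A z i j| * |(z i - p i) * (z j - p j)| := by
        rw [mul_assoc, ← abs_mul]
        exact le_abs_self _
      have h2 : |(z i - p i) * (z j - p j)| ≤ ((z i - p i) ^ 2 + (z j - p j) ^ 2) / 2 := by
        rw [abs_le]
        constructor <;> nlinarith [sq_nonneg (z i - p i + (z j - p j)),
          sq_nonneg (z i - p i - (z j - p j))]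
      exact h1.trans (mul_le_mul (hrB z hz i j).le h2 (abs_nonneg _) hB0.le)
    have hsum : bilin (A z) (fun i => z i - p i) (fun i => z i - p i) ≤
        n * B * ∑ i, (z i - p i) ^ 2 := by
      refine (Finset.sum_le_sum fun i _ => Finset.sum_le_sum fun j _ => hterm i j).trans_eq ?_
      simp only [← Finset.mul_sum, ← Finset.sum_div, Finset.sum_add_distrib]
      simp only [Finset.sum_const, Finset.card_univ, Fintype.card_fin, nsmul_eq_mul,
        ← Finset.mul_sum]
      ring
    have e : bilin (A z) (fun i => 2 * c * (z i - p i)) (fun i => 2 * c * (z i - p i)) =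
        4 * c ^ 2 * bilin (A z) (fun i => z i - p i) (fun i => z i - p i) := by
      simp only [bilin, Finset.mul_sum]
      refine Finset.sum_congr rfl fun i _ => Finset.sum_congr rfl fun j _ => by ring
    rw [e]
    have hcB : c * (n * B) ≤ 1 := by
      rw [hc, one_div, inv_mul_le_iff₀ (by positivity)]
      linarith
    have hS : 0 ≤ ∑ i, (z i - p i) ^ 2 := by positivity
    calc 1 / 4 * (4 * c ^ 2 * bilin (A z) (fun i => z i - p i) (fun i => z i - p i))
        = c ^ 2 * bilin (A z) (fun i => z i - p i) (fun i => z i - p i) := by ring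
      _ ≤ c ^ 2 * (n * B * ∑ i, (z i - p i) ^ 2) := by gcongr
      _ = (c * (n * B)) * (c * ∑ i, (z i - p i) ^ 2) := by ring
      _ ≤ 1 * (c * ∑ i, (z i - p i) ^ 2) := by gcongr
      _ = _ := one_mul _
  · intro z _ hzp
    obtain ⟨i, hi⟩ := Function.ne_iff.1 hzp
    refine mul_pos hc0 (Finset.sum_pos' (fun i _ => sq_nonneg _) ⟨i, Finset.mem_univ i, ?_⟩)
    have : z i - p i ≠ 0 := sub_ne_zero.2 hi
    positivity

/-- The gradient vanishes at the source, so the second derivative of the equation there contains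
only products of second derivatives. It reads `H = ¼ · 2 · H A H`, the two contributions being equal
by symmetry of `A`. -/
theorem hessian_mul_mul (h : IsLocalSolution A V p f) :
    hessian f p * A p * hessian f p = (2 : ℝ) • hessian f p := by
  have hd := fun i => contDiffOn_pderiv h.isOpen h.smooth i
  have hV := h.isOpen
  have e : EqOn f (fun x => 1 / 4 * ∑ k, ∑ l, A x k l * pderiv k f x * pderiv l f x) V :=
    fun x hx => h.eikonal x hx
  have hterm : ∀ k l, ContDiffOn ℝ ∞ (fun x => A x k l * pderiv k f x * pderiv l f x) V :=
    fun k l => ((h.smooth_coeff k l).mul (hd k)).mul (hd l)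
  have hsum : ∀ k, ContDiffOn ℝ ∞ (fun x => ∑ l, A x k l * pderiv k f x * pderiv l f x) V :=
    fun k => ContDiffOn.sum fun l _ => hterm k l
  have key : ∀ i j, pderiv i (pderiv j f) p = 1 / 4 * ∑ k, ∑ l, A p k l *
      (pderiv i (pderiv k f) p * pderiv j (pderiv l f) p +
        pderiv j (pderiv k f) p * pderiv i (pderiv l f) p) := by
    intro i j
    have e1 : EqOn (pderiv j f) (fun x => 1 / 4 * ∑ k, ∑ l,
        pderiv j (fun x => A x k l * pderiv k f x * pderiv l f x) x) V := by
      intro x hx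
      rw [pderiv_eqOn hV e j hx,
        pderiv_const_mul hV (ContDiffOn.sum fun k _ => hsum k) _ j hx]
      simp only
      rw [pderiv_sum _ hV hsum j hx]
      simp only
      congr 1
      exact Finset.sum_congr rfl fun k _ => pderiv_sum _ hV (hterm k) j hx
    have ht' : ∀ k l, ContDiffOn ℝ ∞
        (pderiv j (fun x => A x k l * pderiv k f x * pderiv l f x)) V :=
      fun k l => contDiffOn_pderiv hV (hterm k l) j
    have hs' : ∀ k, ContDiffOn ℝ ∞
        (fun x => ∑ l, pderiv j (fun x => A x k l * pderiv k f x * pderiv l f x) x) V :=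
      fun k => ContDiffOn.sum fun l _ => ht' k l
    rw [pderiv_eqOn hV e1 i h.mem,
      pderiv_const_mul hV (ContDiffOn.sum fun k _ => hs' k) _ i h.mem]
    simp only
    rw [pderiv_sum _ hV hs' i h.mem]
    congr 1
    refine Finset.sum_congr rfl fun k _ => ?_
    rw [pderiv_sum _ hV (ht' k) i h.mem]
    refine Finset.sum_congr rfl fun l _ => ?_
    exact pderiv_pderiv_mul_mul hV h.mem (h.smooth_coeff k l) (hd k) (hd l)
      (h.pderiv_source k) (h.pderiv_source l) i j
  have hA : ∀ k l, A p k l = A p l k := fun k l => by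
    simpa using ((h.posDef p h.mem).1.apply k l).symm
  have hH : ∀ k l, pderiv k (pderiv l f) p = pderiv l (pderiv k f) p := fun k l =>
    pderiv_comm hV h.smooth k l h.mem
  have hsym : ∀ i j, ∑ k, ∑ l, A p k l * (pderiv j (pderiv k f) p * pderiv i (pderiv l f) p) =
      ∑ k, ∑ l, A p k l * (pderiv i (pderiv k f) p * pderiv j (pderiv l f) p) := by
    intro i j
    rw [Finset.sum_comm]
    refine Finset.sum_congr rfl fun k _ => Finset.sum_congr rfl fun l _ => ?_
    rw [hA]; ring
  ext i j
  simp only [Matrix.mul_apply, Matrix.smul_apply, smul_eq_mul, hessian, Matrix.of_apply]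
  rw [key i j]
  simp only [mul_add, Finset.sum_add_distrib]
  rw [hsym i j, ← two_mul, ← mul_assoc, ← mul_assoc]
  norm_num
  rw [Finset.sum_comm]
  refine Finset.sum_congr rfl fun l _ => ?_
  rw [Finset.sum_mul]
  refine Finset.sum_congr rfl fun k _ => ?_
  rw [hH l j]; ring

/-- Along a kernel direction `f` would vanish to second order with zero second derivative, against
its quadratic growth. -/
theorem hessian_mulVec_ne_zero (h : IsLocalSolution A V p f) {v : Fin n → ℝ} (hv : v ≠ 0) :
    hessian f p *ᵥ v ≠ 0 := by
  intro h0
  obtain ⟨c, hc0, hc⟩ := h.exists_quadratic_lower_bound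
  have hp0 : p + (0 : ℝ) • v = p := by simp
  have hev : ∀ᶠ t in 𝓝 (0 : ℝ), c * ∑ i, v i ^ 2 * t ^ 2 ≤ f (p + t • v) := by
    filter_upwards [(tendsto_line p v).eventually hc] with t ht
    simpa [mul_pow, mul_comm] using ht
  have hSpos : 0 < ∑ i, v i ^ 2 := by
    obtain ⟨i, hi⟩ := Function.ne_iff.1 hv
    refine Finset.sum_pos' (fun i _ => sq_nonneg _) ⟨i, Finset.mem_univ i, ?_⟩
    have : v i ≠ 0 := hi
    positivity
  set S := ∑ i, v i ^ 2 with hS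
  -- Subtracting half of the lower bound gives `ψ'(0) = 0` and `ψ''(0) = -cS < 0`. The resulting
  -- local maximum bounds `f` by `(c/2)St²`, below the lower bound `cSt²`.
  set ψ : ℝ → ℝ := fun t => f (p + t • v) - c / 2 * S * t ^ 2 with hψ
  have hmem : ∀ᶠ t in 𝓝 (0 : ℝ), p + t • v ∈ V :=
    (tendsto_line p v).eventually (h.isOpen.mem_nhds h.mem)
  have hd1 : ∀ t, p + t • v ∈ V → HasDerivAt ψ (taylorTerm f p v 1 t - c * S * t) t := by
    intro t ht
    have h1 := hasDerivAt_taylorTerm h.isOpen h.smooth ht 0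
    rw [show taylorTerm f p v 0 = fun s => f (p + s • v) from funext (taylorTerm_zero f p v)] at h1
    refine (h1.sub ((hasDerivAt_pow 2 t).const_mul (c / 2 * S))).congr_deriv ?_
    simp; ring
  have hderiv : deriv ψ =ᶠ[𝓝 0] fun t => taylorTerm f p v 1 t - c * S * t := by
    filter_upwards [hmem] with t ht using (hd1 t ht).deriv
  have hd2 : deriv (deriv ψ) 0 = - (c * S) := by
    rw [hderiv.deriv_eq]
    have h1 := hasDerivAt_taylorTerm_one h.isOpen h.smooth (h := v) hmem.self_of_nhds
    have h2 : ∑ i, ∑ j, v i * v j * pderiv j (pderiv i f) (p + (0 : ℝ) • v) = 0 := by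
      rw [hp0, Finset.sum_comm]
      have : ∀ j, ∑ i, v i * v j * pderiv j (pderiv i f) p = v j * (hessian f p *ᵥ v) j := by
        intro j
        rw [Matrix.mulVec, dotProduct, Finset.mul_sum]
        refine Finset.sum_congr rfl fun i _ => ?_
        rw [hessian, Matrix.of_apply]; ring
      simp [this, h0]
    rw [h2] at h1
    have h3 := h1.sub ((hasDerivAt_id (0 : ℝ)).const_mul (c * S))
    have := h3.deriv
    simpa [Pi.sub_def] using this
  have hd10 : deriv ψ 0 = 0 := by
    rw [(hd1 0 hmem.self_of_nhds).deriv, taylorTerm_one h.isOpen h.smooth hmem.self_of_nhds]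
    simp [h.pderiv_source]
  have hmax := isLocalMax_of_deriv_deriv_neg
    (by rw [hd2]; have := mul_pos hc0 hSpos; linarith) hd10
    (hd1 0 hmem.self_of_nhds).continuousAt
  obtain ⟨t, ⟨ht1, ht2⟩, ht3⟩ :=
    (((hev.and hmax).filter_mono nhdsWithin_le_nhds).and
      (self_mem_nhdsWithin (a := (0 : ℝ)) (s := Ioi 0))).exists
  simp only [hψ, hp0, h.apply_source] at ht2
  rw [← Finset.sum_mul, ← hS] at ht1
  have ht3' : 0 < t := ht3
  have : 0 < c * (S * t ^ 2) := by positivity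
  nlinarith

/-- The Hessian of a solution at the source is twice the inverse of the coefficient matrix. -/
theorem hessian_eq (h : IsLocalSolution A V p f) : hessian f p = (2 : ℝ) • (A p)⁻¹ := by
  have hdet : IsUnit (hessian f p) := by
    rw [← Matrix.mulVec_injective_iff_isUnit]
    intro u v huv
    by_contra hne
    refine h.hessian_mulVec_ne_zero (sub_ne_zero.2 hne) ?_
    rw [Matrix.mulVec_sub, sub_eq_zero]
    exact huv
  have h1 : A p * hessian f p = (2 : ℝ) • (1 : Matrix (Fin n) (Fin n) ℝ) := by
    apply hdet.mul_left_cancel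
    rw [← mul_assoc, h.hessian_mul_mul]
    simp
  have hA : IsUnit (A p).det := (h.posDef p h.mem).det_pos.ne'.isUnit
  calc hessian f p = (A p)⁻¹ * (A p * hessian f p) := by
        rw [← mul_assoc, Matrix.nonsing_inv_mul _ hA, one_mul]
    _ = _ := by rw [h1]; simp

end IsLocalSolution

/-! ### The recursion for the Taylor coefficients -/

section Recursion

theorem exists_eq_unit {γ : Fin n → ℕ} (h : deg γ = 1) : ∃ j, γ = unit j := by
  obtain ⟨j, hj⟩ : ∃ j, γ j ≠ 0 := by
    by_contra! h0
    rw [deg_eq_zero.2 (funext h0)] at h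
    omega
  obtain ⟨δ, rfl⟩ := exists_eq_add_unit hj
  rw [deg_add, deg_unit] at h
  rw [deg_eq_zero.1 (show deg δ = 0 by omega), zero_add]
  exact ⟨j, rfl⟩

theorem unit_injective : Function.Injective (unit : Fin n → Fin n → ℕ) := by
  intro i j h
  have := congrFun h i
  by_contra hij
  simp [unit, hij] at this

variable {A : (Fin n → ℝ) → Matrix (Fin n) (Fin n) ℝ} {V : Set (Fin n → ℝ)}
  {p : Fin n → ℝ} {f : (Fin n → ℝ) → ℝ} {lam : Fin n → ℝ}

namespace IsLocalSolution

/-- The weight `δ i` removes order zero, the critical point at the source removes order one, and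
order two is the diagonal Hessian `2 diag(lam)`. -/
theorem mul_taylorCoeff_of_deg_le_two (h : IsLocalSolution A V p f)
    (hlam : (A p)⁻¹ = Matrix.diagonal lam) {δ : Fin n → ℕ} (hδ : deg δ ≤ 2) (i : Fin n) :
    (δ i : ℝ) * taylorCoeff f p δ = if δ = 2 • unit i then 2 * lam i else 0 := by
  by_cases hi : δ i = 0
  · have : δ ≠ 2 • unit i := by
      rintro rfl
      simp [unit] at hi
    rw [if_neg this, hi, Nat.cast_zero, zero_mul]
  obtain ⟨γ, rfl⟩ := exists_eq_add_unit hi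
  have e : (((γ + unit i) i : ℕ) : ℝ) = (γ i : ℝ) + 1 := by simp [unit]
  rw [e, taylorCoeff_add_unit h.isOpen h.mem h.smooth]
  rw [deg_add, deg_unit] at hδ
  have h01 : deg γ = 0 ∨ deg γ = 1 := by omega
  rcases h01 with h0 | h1
  · rw [deg_eq_zero] at h0
    subst h0
    have : (0 : Fin n → ℕ) + unit i ≠ 2 • unit i := by
      intro h'
      have := congrFun h' i
      simp [unit] at this
    rw [taylorCoeff_zero, h.pderiv_source, if_neg this]
  · obtain ⟨j, rfl⟩ := exists_eq_unit h1
    have h2 := taylorCoeff_add_unit h.isOpen h.mem (contDiffOn_pderiv h.isOpen h.smooth i) 0 j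
    have h3 : pderiv j (pderiv i f) p = hessian f p j i := rfl
    rw [taylorCoeff_zero, h3, h.hessian_eq, hlam] at h2
    simp only [Pi.zero_apply, Nat.cast_zero, zero_add, one_mul, Matrix.smul_apply,
      smul_eq_mul] at h2
    rw [h2, two_smul]
    by_cases hij : j = i
    · subst hij; simp
    · simp [hij, unit_injective.eq_iff]

/-- Coefficient of order `β` in the equation. The coefficient of `∂_i f` at `δ - 1_i` is `δ_i d²_δ`,
so using `δ` and `γ` themselves as indices raises the total index by `1_i + 1_j`. -/
theorem four_mul_taylorCoeff (h : IsLocalSolution A V p f) (β : Fin n → ℕ) :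
    4 * taylorCoeff f p β = ∑ i, ∑ j, ∑ q ∈ triples (β + unit i + unit j),
      taylorCoeff (fun z => A z i j) p q.1 * ((q.2.1 i : ℝ) * taylorCoeff f p q.2.1) *
        ((q.2.2 j : ℝ) * taylorCoeff f p q.2.2) := by
  have hV := h.isOpen
  have hd := fun i => contDiffOn_pderiv hV h.smooth i
  have e : EqOn f (fun x => 1 / 4 * ∑ k, ∑ l, A x k l * pderiv k f x * pderiv l f x) V :=
    fun x hx => h.eikonal x hx
  have hterm : ∀ k l, ContDiffOn ℝ ∞ (fun x => A x k l * pderiv k f x * pderiv l f x) V :=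
    fun k l => ((h.smooth_coeff k l).mul (hd k)).mul (hd l)
  have hsum : ∀ k, ContDiffOn ℝ ∞ (fun x => ∑ l, A x k l * pderiv k f x * pderiv l f x) V :=
    fun k => ContDiffOn.sum fun l _ => hterm k l
  rw [taylorCoeff_congr hV h.mem e, taylorCoeff_const_mul hV h.mem
    (ContDiffOn.sum fun k _ => hsum k), taylorCoeff_sum hV h.mem _ hsum, ← mul_assoc]
  norm_num
  refine Finset.sum_congr rfl fun i _ => ?_
  rw [taylorCoeff_sum hV h.mem _ (hterm i)]
  refine Finset.sum_congr rfl fun j _ => ?_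
  rw [taylorCoeff_mul_mul hV h.mem (h.smooth_coeff i j) (hd i) (hd j)]
  have e2 := sum_triples_snd β i fun a b c => taylorCoeff (fun z => A z i j) p a *
    taylorCoeff f p b * taylorCoeff (pderiv j f) p c
  have e3 := sum_triples_trd (β + unit i) j fun a b c => taylorCoeff (fun z => A z i j) p a *
    ((b i : ℝ) * taylorCoeff f p b) * taylorCoeff f p c
  calc _ = ∑ q ∈ triples β, ((q.2.1 i : ℝ) + 1) * (taylorCoeff (fun z => A z i j) p q.1 *
        taylorCoeff f p (q.2.1 + unit i) * taylorCoeff (pderiv j f) p q.2.2) := by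
        refine Finset.sum_congr rfl fun q _ => ?_
        rw [← taylorCoeff_add_unit hV h.mem h.smooth q.2.1 i]
        ring
    _ = ∑ q ∈ triples (β + unit i), ((q.2.2 j : ℝ) + 1) *
        (taylorCoeff (fun z => A z i j) p q.1 *
          ((q.2.1 i : ℝ) * taylorCoeff f p q.2.1) * taylorCoeff f p (q.2.2 + unit j)) := by
        rw [e2]
        refine Finset.sum_congr rfl fun q _ => ?_
        rw [← taylorCoeff_add_unit hV h.mem h.smooth q.2.2 j]
        ring
    _ = _ := by
        rw [e3]
        refine Finset.sum_congr rfl fun q _ => by ring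

end IsLocalSolution

/-! ### Splitting the coefficients into quadratic and higher part -/

/-- The quadratic part of `δ ↦ δ_i d²_δ`. -/
def quadPart (lam : Fin n → ℝ) (i : Fin n) (δ : Fin n → ℕ) : ℝ :=
  if δ = 2 • unit i then 2 * lam i else 0

/-- The part of order at least three of `δ ↦ δ_i d²_δ`. -/
def highPart (e : (Fin n → ℕ) → ℝ) (i : Fin n) (δ : Fin n → ℕ) : ℝ :=
  if 3 ≤ deg δ then (δ i : ℝ) * e δ else 0

theorem quadPart_self (lam : Fin n → ℝ) (i : Fin n) : quadPart lam i (2 • unit i) = 2 * lam i :=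
  if_pos rfl

theorem quadPart_of_ne (lam : Fin n → ℝ) {i : Fin n} {δ : Fin n → ℕ} (h : δ ≠ 2 • unit i) :
    quadPart lam i δ = 0 :=
  if_neg h

theorem deg_two_smul_unit (i : Fin n) : deg (2 • unit i : Fin n → ℕ) = 2 := by
  rw [two_smul, deg_add, deg_unit]

theorem IsLocalSolution.mul_taylorCoeff (h : IsLocalSolution A V p f)
    (hlam : (A p)⁻¹ = Matrix.diagonal lam) (δ : Fin n → ℕ) (i : Fin n) :
    (δ i : ℝ) * taylorCoeff f p δ = quadPart lam i δ + highPart (taylorCoeff f p) i δ := by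
  unfold quadPart highPart
  by_cases hδ : 3 ≤ deg δ
  · have : δ ≠ 2 • unit i := by
      rintro rfl
      rw [deg_two_smul_unit] at hδ
      omega
    rw [if_neg this, if_pos hδ, zero_add]
  · rw [h.mul_taylorCoeff_of_deg_le_two hlam (by omega) i, if_neg hδ, add_zero]

/-- Only `δ = 2 • 1_i` and `γ = 2 • 1_j` contribute, which fixes `α`. The two factors 2 give the 4.
-/
theorem sum_quadPart_mul_quadPart (t : (Fin n → ℕ) → ℝ) (lam : Fin n → ℝ) (β : Fin n → ℕ)
    (i j : Fin n) :
    ∑ q ∈ triples (β + unit i + unit j), t q.1 * quadPart lam i q.2.1 * quadPart lam j q.2.2 =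
      4 * if ∀ k, (unit i + unit j) k ≤ β k then
        lam i * lam j * t (β - (unit i + unit j)) else 0 := by
  have hmem : ∀ α : Fin n → ℕ, (α, 2 • unit i, 2 • unit j) ∈ triples (β + unit i + unit j) ↔
      α + (unit i + unit j) = β := by
    intro α
    rw [mem_triples, two_smul, two_smul]
    constructor
    · intro h
      apply add_right_cancel (b := unit i + unit j)
      calc _ = α + (unit i + unit i) + (unit j + unit j) := by abel
        _ = _ := h
        _ = _ := by abel
    · intro h
      simp only [← h]; abel
  split_ifs with hle
  · have hα : β - (unit i + unit j) + (unit i + unit j) = β := by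
      funext k
      have := hle k
      simp only [Pi.add_apply, Pi.sub_apply] at this ⊢
      omega
    rw [Finset.sum_eq_single (β - (unit i + unit j), 2 • unit i, 2 • unit j)]
    · simp only [quadPart_self]; ring
    · rintro ⟨a, b, c⟩ hq hne
      by_cases hb : b = 2 • unit i
      · by_cases hc : c = 2 • unit j
        · subst hb hc
          rw [hmem] at hq
          refine absurd ?_ hne
          rw [← hq]
          simp
        · simp [quadPart_of_ne lam hc]
      · simp [quadPart_of_ne lam hb]
    · intro hn
      exact absurd ((hmem _).2 hα) hn
  · rw [mul_zero]
    refine Finset.sum_eq_zero ?_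
    rintro ⟨a, b, c⟩ hq
    by_cases hb : b = 2 • unit i
    · by_cases hc : c = 2 • unit j
      · subst hb hc
        rw [hmem] at hq
        refine absurd (fun k => ?_) hle
        rw [← hq]
        simp
      · simp [quadPart_of_ne lam hc]
    · simp [quadPart_of_ne lam hb]

/-- The quadratic factor forces `δ = 2 • 1_i`. The terms with `α = 0` are separated because they
carry the unknown of order `|β|`: since `A 0` is inverse to `diag(lam)`, they vanish for `i ≠ j`,
and for `i = j` they leave only `γ = β`. -/
theorem sum_quadPart_mul_highPart {t : (Fin n → ℕ) → ℝ} {lam : Fin n → ℝ} {β : Fin n → ℕ}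
    {i j : Fin n} (e : (Fin n → ℕ) → ℝ) (hβ : 3 ≤ deg β)
    (ht : t 0 * lam i = if i = j then 1 else 0) :
    ∑ q ∈ triples (β + unit i + unit j), t q.1 * quadPart lam i q.2.1 * highPart e j q.2.2 =
      2 * (∑ p ∈ (Finset.Iic (β + unit j) ×ˢ Finset.Iic (β + unit j)).filter
          (fun p => 1 ≤ deg p.1 ∧ 3 ≤ deg p.2 ∧ p.1 + unit i + p.2 = β + unit j),
        t p.1 * lam i * (p.2 j : ℝ) * e p.2) +
      if i = j then 2 * ((β i : ℝ) * e β) else 0 := by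
  have hmem : ∀ α γ : Fin n → ℕ, (α, 2 • unit i, γ) ∈ triples (β + unit i + unit j) ↔
      α + unit i + γ = β + unit j := by
    intro α γ
    rw [mem_triples, two_smul]
    constructor
    · intro h
      apply add_right_cancel (b := unit i)
      calc _ = α + (unit i + unit i) + γ := by abel
        _ = _ := h
        _ = _ := by abel
    · intro h
      calc _ = (α + unit i + γ) + unit i := by abel_nf
        _ = _ := by rw [h]; abel
  rw [← Finset.sum_filter_add_sum_filter_not _ (fun q => 1 ≤ deg q.1)]
  congr 1
  · rw [Finset.mul_sum]
    refine Finset.sum_bij_ne_zero (fun q _ _ => (q.1, q.2.2)) ?_ ?_ ?_ ?_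
    · rintro ⟨a, b, c⟩ hq h0
      obtain ⟨hq, ha⟩ := Finset.mem_filter.1 hq
      have hb : b = 2 • unit i := by
        by_contra hb; simp [quadPart_of_ne lam hb] at h0
      have hc : 3 ≤ deg c := by
        by_contra hc; simp [highPart, hc] at h0
      subst hb
      rw [hmem] at hq
      simp only [Finset.mem_filter, Finset.mem_product, Finset.mem_Iic]
      refine ⟨⟨?_, ?_⟩, ha, hc, hq⟩
      · rw [← hq, add_assoc]; exact le_self_add
      · rw [← hq]; exact le_add_self
    · rintro ⟨a, b, c⟩ hq h0 ⟨a', b', c'⟩ hq' h0' heq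
      have hb : b = 2 • unit i := by
        by_contra hb; simp [quadPart_of_ne lam hb] at h0
      have hb' : b' = 2 • unit i := by
        by_contra hb; simp [quadPart_of_ne lam hb] at h0'
      simp only [Prod.mk.injEq] at heq
      rw [heq.1, heq.2, hb, hb']
    · rintro ⟨a, c⟩ hp h0
      simp only [Finset.mem_filter, Finset.mem_product, Finset.mem_Iic] at hp
      refine ⟨(a, 2 • unit i, c), Finset.mem_filter.2 ⟨(hmem a c).2 hp.2.2.2, hp.2.1⟩, ?_, rfl⟩
      simp only [quadPart_self, highPart, hp.2.2.1, if_true]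
      convert h0 using 1
      ring
    · rintro ⟨a, b, c⟩ hq h0
      have hb : b = 2 • unit i := by
        by_contra hb; simp [quadPart_of_ne lam hb] at h0
      have hc : 3 ≤ deg c := by
        by_contra hc; simp [highPart, hc] at h0
      simp only [hb, quadPart_self, highPart, hc, if_true]
      ring
  · split_ifs with hij
    · subst hij
      rw [if_pos rfl] at ht
      rw [Finset.sum_eq_single (0, 2 • unit i, β)]
      · simp only [quadPart_self, highPart, hβ, if_true]
        linear_combination 2 * ((β i : ℝ) * e β) * ht
      · rintro ⟨a, b, c⟩ hq hne
        obtain ⟨hq, ha⟩ := Finset.mem_filter.1 hq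
        have ha0 : a = 0 := deg_eq_zero.1 (by simp only at ha; omega)
        by_cases hb : b = 2 • unit i
        · subst hb ha0
          rw [hmem] at hq
          refine absurd ?_ hne
          have : c = β := by
            apply add_right_cancel (b := unit i)
            rw [← hq]; abel
          rw [this]
        · simp [quadPart_of_ne lam hb]
      · intro hn
        refine absurd (Finset.mem_filter.2 ⟨(hmem _ _).2 ?_, by simp [deg_zero]⟩) hn
        abel
    · rw [if_neg hij] at ht
      refine Finset.sum_eq_zero ?_
      rintro ⟨a, b, c⟩ hq
      have ha := (Finset.mem_filter.1 hq).2
      have ha0 : a = 0 := deg_eq_zero.1 (by simp only at ha; omega)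
      subst ha0
      by_cases hb : b = 2 • unit i
      · simp only [hb, quadPart_self]
        linear_combination 2 * highPart e j c * ht
      · simp [quadPart_of_ne lam hb]

theorem sum_highPart_mul_quadPart (t : (Fin n → ℕ) → ℝ) (lam : Fin n → ℝ) (β : Fin n → ℕ)
    (i j : Fin n) (e : (Fin n → ℕ) → ℝ) :
    ∑ q ∈ triples (β + unit i + unit j), t q.1 * highPart e i q.2.1 * quadPart lam j q.2.2 =
    ∑ q ∈ triples (β + unit j + unit i), t q.1 * quadPart lam j q.2.1 * highPart e i q.2.2 := by
  refine Finset.sum_nbij' (fun q => (q.1, q.2.2, q.2.1)) (fun q => (q.1, q.2.2, q.2.1))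
    ?_ ?_ ?_ ?_ ?_ <;> intro q hq
  · rw [mem_triples] at hq ⊢
    rw [add_right_comm] at hq
    rw [hq, add_right_comm]
  · rw [mem_triples] at hq ⊢
    rw [add_right_comm] at hq
    rw [hq, add_right_comm]
  · rfl
  · rfl
  · ring

theorem sum_highPart_mul_highPart (t : (Fin n → ℕ) → ℝ) (β : Fin n → ℕ)
    (i j : Fin n) (e : (Fin n → ℕ) → ℝ) :
    ∑ q ∈ triples (β + unit i + unit j), t q.1 * highPart e i q.2.1 * highPart e j q.2.2 =
    ∑ p ∈ (Finset.Iic (β + unit i + unit j) ×ˢ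
          (Finset.Iic (β + unit i + unit j) ×ˢ Finset.Iic (β + unit i + unit j))).filter
          (fun p => 3 ≤ deg p.2.1 ∧ 3 ≤ deg p.2.2 ∧
            p.1 + p.2.1 + p.2.2 = β + unit i + unit j),
        t p.1 * (p.2.1 i : ℝ) * (p.2.2 j : ℝ) * e p.2.1 * e p.2.2 := by
  rw [triples, Finset.sum_filter, Finset.sum_filter]
  refine Finset.sum_congr rfl fun q _ => ?_
  by_cases h1 : 3 ≤ deg q.2.1 <;> by_cases h2 : 3 ≤ deg q.2.2 <;>
    by_cases h3 : q.1 + q.2.1 + q.2.2 = β + unit i + unit j <;> simp [highPart, h1, h2, h3]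
  ring

/-- The Taylor coefficients of a solution satisfy the recursion. -/
theorem IsLocalSolution.taylorCoeff_eq_recursionRHS (h : IsLocalSolution A V 0 f)
    (hlam : (A 0)⁻¹ = Matrix.diagonal lam) {β : Fin n → ℕ} (hβ : 3 ≤ deg β) :
    taylorCoeff f 0 β = recursionRHS lam A (taylorCoeff f 0) β := by
  set e := taylorCoeff f 0 with he
  have hsymm : ∀ i j, taylorCoeff (fun z => A z i j) 0 = taylorCoeff (fun z => A z j i) 0 := by
    intro i j
    funext α
    refine taylorCoeff_congr h.isOpen h.mem (fun z hz => ?_) α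
    simpa using ((h.posDef z hz).1.apply i j).symm
  have hA0 : ∀ i j, A 0 i j * lam i = if i = j then 1 else 0 := by
    have h1 : Matrix.diagonal lam * A 0 = 1 := by
      rw [← hlam]
      exact Matrix.nonsing_inv_mul _ (h.posDef 0 h.mem).det_pos.ne'.isUnit
    intro i j
    have h2 := congrFun (congrFun h1 i) j
    rw [Matrix.diagonal_mul, Matrix.one_apply] at h2
    rw [← h2, mul_comm]
  have key : ∀ i j, ∑ q ∈ triples (β + unit i + unit j),
      taylorCoeff (fun z => A z i j) 0 q.1 * ((q.2.1 i : ℝ) * e q.2.1) *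
        ((q.2.2 j : ℝ) * e q.2.2) =
      4 * (if ∀ k, (unit i + unit j) k ≤ β k then
        lam i * lam j * taylorCoeff (fun z => A z i j) 0 (β - (unit i + unit j)) else 0) +
      (2 * (∑ p ∈ (Finset.Iic (β + unit j) ×ˢ Finset.Iic (β + unit j)).filter
          (fun p => 1 ≤ deg p.1 ∧ 3 ≤ deg p.2 ∧ p.1 + unit i + p.2 = β + unit j),
        taylorCoeff (fun z => A z i j) 0 p.1 * lam i * (p.2 j : ℝ) * e p.2) +
      if i = j then 2 * ((β i : ℝ) * e β) else 0) +
      (2 * (∑ p ∈ (Finset.Iic (β + unit i) ×ˢ Finset.Iic (β + unit i)).filter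
          (fun p => 1 ≤ deg p.1 ∧ 3 ≤ deg p.2 ∧ p.1 + unit j + p.2 = β + unit i),
        taylorCoeff (fun z => A z j i) 0 p.1 * lam j * (p.2 i : ℝ) * e p.2) +
      if j = i then 2 * ((β j : ℝ) * e β) else 0) +
      ∑ p ∈ (Finset.Iic (β + unit i + unit j) ×ˢ
          (Finset.Iic (β + unit i + unit j) ×ˢ Finset.Iic (β + unit i + unit j))).filter
          (fun p => 3 ≤ deg p.2.1 ∧ 3 ≤ deg p.2.2 ∧
            p.1 + p.2.1 + p.2.2 = β + unit i + unit j),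
        taylorCoeff (fun z => A z i j) 0 p.1 * (p.2.1 i : ℝ) * (p.2.2 j : ℝ)
          * e p.2.1 * e p.2.2 := by
    intro i j
    rw [← sum_quadPart_mul_quadPart, ← sum_highPart_mul_highPart,
      ← sum_quadPart_mul_highPart e hβ (by rw [taylorCoeff_zero]; exact hA0 i j),
      ← sum_quadPart_mul_highPart e hβ (by rw [taylorCoeff_zero]; exact hA0 j i),
      hsymm j i, ← sum_highPart_mul_quadPart _ lam β i j, ← Finset.sum_add_distrib, ← Finset.sum_add_distrib,
      ← Finset.sum_add_distrib]
    refine Finset.sum_congr rfl fun q _ => ?_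
    rw [he, h.mul_taylorCoeff hlam, h.mul_taylorCoeff hlam]
    ring
  have hmain := h.four_mul_taylorCoeff β
  rw [← he] at hmain
  rw [Finset.sum_congr rfl fun i _ => Finset.sum_congr rfl fun j _ => key i j] at hmain
  simp only [Finset.sum_add_distrib] at hmain
  -- The entries of `β` sum to `|β|`, so both mixed products together carry `4|β| d²_β`. Against `4
  -- d²_β` on the left this leaves the factor `1 - |β|`.
  have hdiag : ∑ i : Fin n, ∑ j, (if i = j then 2 * ((β i : ℝ) * e β) else 0) =
      2 * (deg β * e β) := by
    simp [deg, Finset.mul_sum, Finset.sum_mul]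
  have hdiag' : ∑ i : Fin n, ∑ j, (if j = i then 2 * ((β j : ℝ) * e β) else 0) =
      2 * (deg β * e β) := by
    rw [Finset.sum_comm, hdiag]
  rw [hdiag, hdiag'] at hmain
  -- Exchanging `i` and `j` identifies the second mixed sum with the first.
  have hcomm := Finset.sum_comm (s := (Finset.univ : Finset (Fin n)))
    (t := (Finset.univ : Finset (Fin n))) (f := fun i j =>
      2 * (∑ p ∈ (Finset.Iic (β + unit i) ×ˢ Finset.Iic (β + unit i)).filter
          (fun p => 1 ≤ deg p.1 ∧ 3 ≤ deg p.2 ∧ p.1 + unit j + p.2 = β + unit i),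
        taylorCoeff (fun z => A z j i) 0 p.1 * lam j * (p.2 i : ℝ) * e p.2))
  rw [hcomm] at hmain
  simp only [← Finset.mul_sum] at hmain
  have hβ' : (1 : ℝ) - deg β ≠ 0 := by
    have : (3 : ℝ) ≤ deg β := by exact_mod_cast hβ
    linarith
  rw [recursionRHS, one_div, eq_inv_mul_iff_mul_eq₀ hβ']
  linarith

/-- The right-hand side of the recursion involves only coefficients of lower order. -/
theorem recursionRHS_congr {e e' : (Fin n → ℕ) → ℝ} {β : Fin n → ℕ}
    (h : ∀ γ, 3 ≤ deg γ → deg γ < deg β → e γ = e' γ) :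
    recursionRHS lam A e β = recursionRHS lam A e' β := by
  unfold recursionRHS
  congr 3
  · refine Finset.sum_congr rfl fun i _ => Finset.sum_congr rfl fun j _ =>
      Finset.sum_congr rfl fun q hq => ?_
    obtain ⟨-, h1, h2, h3⟩ := Finset.mem_filter.1 hq
    -- Here `|α| + |γ| = |β|` with `|α| ≥ 1`, hence `|γ| < |β|`.
    have := congrArg deg h3
    simp only [deg_add, deg_unit] at this
    rw [h _ h2 (by omega)]
  · refine Finset.sum_congr rfl fun i _ => Finset.sum_congr rfl fun j _ =>
      Finset.sum_congr rfl fun q hq => ?_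
    obtain ⟨-, h1, h2, h3⟩ := Finset.mem_filter.1 hq
    -- Here `|δ| + |γ| ≤ |β| + 2` with both at least 3, hence both are below `|β|`.
    have := congrArg deg h3
    simp only [deg_add, deg_unit] at this
    rw [h _ h1 (by omega), h _ h2 (by omega)]

/-- The recursion has at most one solution. -/
theorem recursion_unique {e e' : (Fin n → ℕ) → ℝ}
    (he : ∀ β, 3 ≤ deg β → e β = recursionRHS lam A e β)
    (he' : ∀ β, 3 ≤ deg β → e' β = recursionRHS lam A e' β) (β : Fin n → ℕ) (hβ : 3 ≤ deg β) :
    e β = e' β := by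
  induction hk : deg β using Nat.strong_induction_on generalizing β with
  | _ k ih =>
    rw [he β hβ, he' β hβ]
    exact recursionRHS_congr fun γ hγ hlt => ih _ (hk ▸ hlt) γ hγ rfl

/-- The recursion for a diagonal coefficient matrix. -/
theorem recursionRHS_eq_diagonalRecursionRHS
    (hA : ∀ i j, i ≠ j → ∀ α, taylorCoeff (fun z => A z i j) 0 α = 0)
    (e : (Fin n → ℕ) → ℝ) (β : Fin n → ℕ) :
    recursionRHS lam A e β = diagonalRecursionRHS lam (fun i z => A z i i) e β := by
  unfold recursionRHS diagonalRecursionRHS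
  congr 3
  · refine Finset.sum_congr rfl fun i _ => ?_
    rw [Finset.sum_eq_single i (fun j _ hj => by simp [hA i j hj.symm]) (by simp)]
    have hiff : (∀ k, (unit i + unit i) k ≤ β k) ↔ 2 ≤ β i := by
      constructor
      · intro h
        simpa [unit] using h i
      · intro h k
        by_cases hk : k = i
        · subst hk; simpa [unit] using h
        · simp [unit, hk]
    simp only [hiff, two_smul, pow_two]
  · refine Finset.sum_congr rfl fun i _ => ?_
    rw [Finset.sum_eq_single i (fun j _ hj => by simp [hA i j hj.symm]) (by simp)]
    refine Finset.sum_congr ?_ fun _ _ => rfl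
    ext q
    have hiff : q.1 + unit i + q.2 = β + unit i ↔ q.1 + q.2 = β := by
      rw [add_right_comm, add_left_inj]
    simp only [Finset.mem_filter, Finset.mem_product, Finset.mem_Iic, hiff]
    constructor
    · rintro ⟨-, h1, h2, h3⟩
      exact ⟨⟨h3 ▸ le_self_add, h3 ▸ le_add_self⟩, h1, h2, h3⟩
    · rintro ⟨⟨h4, h5⟩, h⟩
      exact ⟨⟨h4.trans le_self_add, h5.trans le_self_add⟩, h⟩
  · refine Finset.sum_congr rfl fun i _ => ?_
    rw [Finset.sum_eq_single i (fun j _ hj => by simp [hA i j hj.symm]) (by simp)]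
    simp only [two_smul, add_assoc]

end Recursion

/-! ### Local solutions from solutions, and orthogonal coordinates -/

section Coordinates

variable {Ω : Set (Fin n → ℝ)} {a : (Fin n → ℝ) → Matrix (Fin n) (Fin n) ℝ}
  {U U' : Set ((Fin n → ℝ) × (Fin n → ℝ))} {D D' : (Fin n → ℝ) → (Fin n → ℝ) → ℝ}
  {y : Fin n → ℝ}

theorem IsSolution.isLocalSolution (ha : IsCoefficientField a Ω) (h : IsSolution a Ω U D)
    (hy : y ∈ Ω) : IsLocalSolution a {x | (x, y) ∈ U} y (fun x => D x y) where
  isOpen := h.isOpen.preimage (by fun_prop)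
  mem := h.diag y hy
  smooth_coeff i j := (ha.smooth i j).mono fun _ hx => (h.subset hx).1
  posDef x hx := ha.posDef x (h.subset hx).1
  smooth := h.smooth.comp (f := fun x => (x, y)) (by fun_prop) fun _ hx => hx
  eikonal x hx := h.eikonal_x x y hx
  boundary x hx := h.boundary x y hx

/-- Of two solutions, the first is locally dominated by the second. -/
theorem IsSolution.eventually_le (ha : IsCoefficientField a Ω)
    (h : IsSolution a Ω U D) (h' : IsSolution a Ω U' D') (hy : y ∈ Ω) :
    ∀ᶠ p : (Fin n → ℝ) × (Fin n → ℝ) in 𝓝 (y, y), D p.1 p.2 ≤ D' p.1 p.2 := by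
  obtain ⟨r, hr0, hr⟩ := Metric.nhds_basis_closedBall.mem_iff.1
    (Filter.inter_mem (h.isOpen.mem_nhds (h.diag y hy)) (h'.isOpen.mem_nhds (h'.diag y hy)))
  rw [← closedBall_prod_same] at hr
  have hU : ∀ x ∈ Metric.closedBall y r, ∀ w ∈ Metric.closedBall y r, (x, w) ∈ U :=
    fun x hx w hw => (hr (mk_mem_prod hx hw)).1
  have hU' : ∀ x ∈ Metric.closedBall y r, ∀ w ∈ Metric.closedBall y r, (x, w) ∈ U' :=
    fun x hx w hw => (hr (mk_mem_prod hx hw)).2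
  have hΩ : ∀ w ∈ Metric.closedBall y r, w ∈ Ω := fun w hw => (h.subset (hU w hw w hw)).1
  have hhalf : Metric.closedBall y (r / 2) ⊆ Metric.closedBall y r :=
    Metric.closedBall_subset_closedBall (by linarith)
  -- A lower bound uniform in the source `w`, so that one level `m / 2` serves all nearby sources.
  -- Restricting `w` to the ball of half the radius keeps it off the sphere.
  obtain ⟨m, hm0, hm⟩ := ((isCompact_sphere y r).prod
    (isCompact_closedBall y (r / 2))).exists_forall_le' (a := 0)
    (h'.smooth.continuousOn.mono fun q hq =>
      hU' _ (Metric.sphere_subset_closedBall hq.1) _ (hhalf hq.2))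
    (by
      rintro ⟨x, w⟩ ⟨hx, hw⟩
      have hx' : dist x y = r := hx
      have hw' : dist w y ≤ r / 2 := hw
      refine (h'.isLocalSolution ha (hΩ w (hhalf hw))).pos
        (hU' _ (Metric.sphere_subset_closedBall hx) _ (hhalf hw)) ?_
      intro hxw
      simp only at hxw
      rw [hxw] at hx'
      linarith)
  have hcont : ContinuousAt (fun p : (Fin n → ℝ) × (Fin n → ℝ) => D' p.1 p.2) (y, y) :=
    h'.smooth.continuousOn.continuousAt (h'.isOpen.mem_nhds (h'.diag y hy))
  have h0 : D' y y = 0 := (h'.boundary y y (h'.diag y hy)).2 rfl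
  filter_upwards [hcont.eventually (gt_mem_nhds (show D' y y < m / 2 by rw [h0]; linarith)),
    prod_mem_nhds (Metric.closedBall_mem_nhds y hr0)
      (Metric.closedBall_mem_nhds y (half_pos hr0))] with q hq1 hq2
  obtain ⟨x, w⟩ := q
  have hw := hhalf hq2.2
  have hs := h.isLocalSolution ha (hΩ w hw)
  exact (h'.isLocalSolution ha (hΩ w hw)).le_of_sphere (F := fun x => D x w)
    (fun z hz => hU' z hz w hw)
    (fun z hz => differentiableAt_of_contDiffOn hs.isOpen hs.smooth (hU z hz w hw))
    (fun z hz => (hs.eikonal z (hU z hz w hw)).ge) hs.apply_source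
    (fun z hz hzw => hs.pos (hU z hz w hw) hzw)
    (fun z hz => by linarith [hm (z, w) ⟨hz, hq2.2⟩]) hq2.1 hq1.le

theorem IsSolution.eventuallyEq (ha : IsCoefficientField a Ω)
    (h : IsSolution a Ω U D) (h' : IsSolution a Ω U' D') (hy : y ∈ Ω) :
    ∀ᶠ p : (Fin n → ℝ) × (Fin n → ℝ) in 𝓝 (y, y), D p.1 p.2 = D' p.1 p.2 := by
  filter_upwards [h.eventually_le ha h' hy, h'.eventually_le ha h hy] with p h1 h2
  exact le_antisymm h1 h2

theorem exists_isNormalForm (h : (a y).PosDef) :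
    ∃ (Q : Matrix (Fin n) (Fin n) ℝ) (lam : Fin n → ℝ), IsNormalForm a y Q lam := by
  have hH := h.inv.1
  refine ⟨hH.eigenvectorUnitary, hH.eigenvalues, hH.eigenvectorUnitary.2, ?_⟩
  have := hH.conjStarAlgAut_star_eigenvectorUnitary
  rw [Unitary.conjStarAlgAut_star_apply] at this
  simpa [Matrix.star_eq_conjTranspose, Function.comp_def] using this

theorem pderiv_comp_mulVec {f : (Fin n → ℝ) → ℝ} {Q : Matrix (Fin n) (Fin n) ℝ}
    {z : Fin n → ℝ} (hf : DifferentiableAt ℝ f (y + Q *ᵥ z)) (i : Fin n) :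
    pderiv i (fun z => f (y + Q *ᵥ z)) z = (Qᵀ *ᵥ grad f (y + Q *ᵥ z)) i := by
  have h1 : HasFDerivAt (fun z => y + Q *ᵥ z) Q.mulVecLin.toContinuousLinearMap z :=
    Q.mulVecLin.toContinuousLinearMap.hasFDerivAt.const_add y
  have h2 := (hf.hasFDerivAt.comp z h1).fderiv
  simp only [Function.comp_def] at h2
  rw [pderiv, h2]
  simp only [ContinuousLinearMap.comp_apply, LinearMap.coe_toContinuousLinearMap',
    Matrix.mulVecLin_apply, fderiv_apply_eq_sum, Matrix.mulVec_single_one]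
  rfl

/-- The gradient becomes `Qᵀ∇f` and the matrix `QᵀAQ`; the quadratic form is unchanged because `QQᵀ
= 1`. -/
theorem IsLocalSolution.inCoords {V : Set (Fin n → ℝ)} {f : (Fin n → ℝ) → ℝ}
    (h : IsLocalSolution a V y f) {Q : Matrix (Fin n) (Fin n) ℝ}
    (hQ : Q ∈ Matrix.orthogonalGroup (Fin n) ℝ) :
    IsLocalSolution (coeffInCoords a y Q) {z | y + Q *ᵥ z ∈ V} 0 (fun z => f (y + Q *ᵥ z)) := by
  have hQ1 : Qᵀ * Q = 1 := (Matrix.mem_orthogonalGroup_iff' _ _).1 hQ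
  have hQ2 : Q * Qᵀ = 1 := (Matrix.mem_orthogonalGroup_iff _ _).1 hQ
  have hinj : Function.Injective Q.mulVec := fun u v huv => by
    have := congrArg (Qᵀ *ᵥ ·) huv
    simpa [Matrix.mulVec_mulVec, hQ1] using this
  have hcd : ContDiff ℝ ∞ fun z => y + Q *ᵥ z :=
    contDiff_const.add Q.mulVecLin.toContinuousLinearMap.contDiff
  have hcoe : ∀ {g : (Fin n → ℝ) → ℝ}, ContDiffOn ℝ ∞ g V →
      ContDiffOn ℝ ∞ (fun z => g (y + Q *ᵥ z)) {z | y + Q *ᵥ z ∈ V} :=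
    fun hg => hg.comp (f := fun z => y + Q *ᵥ z) hcd.contDiffOn fun _ hz => hz
  refine ⟨h.isOpen.preimage hcd.continuous, ?_, ?_, ?_, hcoe h.smooth, ?_, ?_⟩
  · simpa using h.mem
  · intro i j
    simp only [coeffInCoords, Matrix.mul_apply]
    exact ContDiffOn.sum fun k _ => (ContDiffOn.sum fun l _ =>
      contDiffOn_const.mul (hcoe (h.smooth_coeff l k))).mul contDiffOn_const
  · intro z hz
    simpa [coeffInCoords, Matrix.conjTranspose_eq_transpose_of_trivial] using
      (h.posDef _ hz).conjTranspose_mul_mul_same hinj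
  · intro z hz
    have hg : grad (fun z => f (y + Q *ᵥ z)) z = Qᵀ *ᵥ grad f (y + Q *ᵥ z) :=
      funext (pderiv_comp_mulVec (differentiableAt_of_contDiffOn h.isOpen h.smooth hz))
    rw [h.eikonal _ hz, hg, bilin_eq, bilin_eq, coeffInCoords, Matrix.mulVec_mulVec, mul_assoc,
      hQ2, mul_one, ← Matrix.mulVec_mulVec, Matrix.dotProduct_mulVec (Qᵀ *ᵥ _) Qᵀ,
      Matrix.vecMul_transpose, Matrix.mulVec_mulVec, hQ2, Matrix.one_mulVec]
  · intro z hz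
    rw [h.boundary _ hz, add_eq_left]
    constructor
    · intro h0
      exact hinj (by rw [h0, Matrix.mulVec_zero])
    · rintro rfl
      exact Matrix.mulVec_zero Q

theorem IsNormalForm.inv_coeffInCoords {Q : Matrix (Fin n) (Fin n) ℝ} {lam : Fin n → ℝ}
    (h : IsNormalForm a y Q lam) : (coeffInCoords a y Q 0)⁻¹ = Matrix.diagonal lam := by
  have hQ1 : Qᵀ * Q = 1 := (Matrix.mem_orthogonalGroup_iff' _ _).1 h.1
  have hinv : Q⁻¹ = Qᵀ := Matrix.inv_eq_left_inv hQ1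
  have hinv' : Qᵀ⁻¹ = Q := Matrix.inv_eq_right_inv hQ1
  rw [← h.2, coeffInCoords, Matrix.mulVec_zero, add_zero, Matrix.mul_inv_rev,
    Matrix.mul_inv_rev, hinv, hinv', mul_assoc]

/-- The expansion of a solution at the source, with the second order term made explicit. -/
theorem IsLocalSolution.taylor {V : Set (Fin n → ℝ)} {f : (Fin n → ℝ) → ℝ}
    (h : IsLocalSolution a V y f) {x : Fin n → ℝ}
    (hseg : ∀ θ ∈ Icc (0 : ℝ) 1, y + θ • (x - y) ∈ V) {M : ℕ} (hM : 3 ≤ M) :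
    f x = (∑ i, ∑ j, (a y)⁻¹ i j * (x i - y i) * (x j - y j))
      + (∑ k ∈ Finset.Ico 3 M, ∑ α ∈ Finset.piAntidiag (Finset.univ : Finset (Fin n)) k,
          mderiv α f y / (mfact α : ℝ) * mpow (x - y) α)
      + (M : ℝ) * ∑ γ ∈ Finset.piAntidiag (Finset.univ : Finset (Fin n)) M,
          ∫ θ in (0 : ℝ)..1, (1 - θ) ^ (M - 1) * (mpow (x - y) γ / (mfact γ : ℝ)) *
            mderiv γ f (y + θ • (x - y)) := by
  have h0 := hseg 0 (by simp)
  have hy : y + (0 : ℝ) • (x - y) = y := by simp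
  have hT := taylor_formula h.isOpen h.smooth hseg (show 1 ≤ M by omega)
  rw [add_sub_cancel] at hT
  rw [hT]
  congr 1
  rw [← Finset.sum_range_add_sum_Ico _ hM]
  congr 1
  -- Orders zero and one vanish at the source. Order two is half the Hessian, that is `(a y)⁻¹`.
  · have h2 := taylorTerm_two h.isOpen h.smooth h0
    rw [Finset.sum_range_succ, Finset.sum_range_succ, Finset.sum_range_one, taylorTerm_zero,
      taylorTerm_one h.isOpen h.smooth h0]
    simp only [hy, h.apply_source, h.pderiv_source, mul_zero, Finset.sum_const_zero,
      zero_add] at h2 ⊢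
    have h3 : ∀ i j, pderiv j (pderiv i f) y = 2 * (a y)⁻¹ i j := by
      intro i j
      have : hessian f y i j = 2 * (a y)⁻¹ i j := by rw [h.hessian_eq]; rfl
      rw [← this]
      exact pderiv_comm h.isOpen h.smooth j i h.mem
    have h4 : 2 * taylorTerm f y (x - y) 2 0 =
        2 * ∑ i, ∑ j, (a y)⁻¹ i j * (x i - y i) * (x j - y j) := by
      rw [h2]
      simp only [Finset.mul_sum, h3, Pi.sub_apply]
      refine Finset.sum_congr rfl fun i _ => Finset.sum_congr rfl fun j _ => by ring
    linarith
  · refine Finset.sum_congr rfl fun k _ => Finset.sum_congr rfl fun α _ => ?_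
    rw [hy]
    ring

end Coordinates

/-! ### An analytic coefficient field without globally analytic solutions -/

section Arctan

/-- The coefficient field `diag ((1 + xᵢ²)²)`. -/
def arctanCoeff (x : Fin n → ℝ) : Matrix (Fin n) (Fin n) ℝ :=
  Matrix.diagonal fun i => (1 + x i ^ 2) ^ 2

/-- The squared distance for `arctanCoeff`. -/
noncomputable def arctanDist (x y : Fin n → ℝ) : ℝ :=
  ∑ i, (Real.arctan (x i) - Real.arctan (y i)) ^ 2

theorem analyticOnNhd_arctanCoeff (i j : Fin n) :
    AnalyticOnNhd ℝ (fun x : Fin n → ℝ => arctanCoeff x i j) univ := by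
  by_cases hij : i = j
  · subst hij
    simp only [arctanCoeff, Matrix.diagonal_apply_eq]
    have hp : AnalyticOnNhd ℝ (fun x : Fin n → ℝ => x i) univ :=
      (ContinuousLinearMap.proj (R := ℝ) (φ := fun _ : Fin n => ℝ) i).analyticOnNhd univ
    exact (analyticOnNhd_const.add (hp.pow 2)).pow 2
  · simp only [arctanCoeff, Matrix.diagonal_apply_ne _ hij]
    exact analyticOnNhd_const

theorem isCoefficientField_arctanCoeff :
    IsCoefficientField (arctanCoeff (n := n)) univ where
  smooth i j := ((analyticOnNhd_arctanCoeff i j).contDiffOn uniqueDiffOn_univ)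
  posDef x _ := Matrix.PosDef.diagonal fun i => by positivity

theorem pderiv_arctanDist (x y : Fin n → ℝ) (i : Fin n) :
    pderiv i (fun x' => arctanDist x' y) x =
      2 * (Real.arctan (x i) - Real.arctan (y i)) / (1 + x i ^ 2) := by
  have hder : HasFDerivAt (fun x' : Fin n → ℝ => arctanDist x' y)
      (∑ k, (2 * (Real.arctan (x k) - Real.arctan (y k)) * (1 / (1 + x k ^ 2))) •
        ContinuousLinearMap.proj (R := ℝ) (φ := fun _ : Fin n => ℝ) k) x := by
    refine HasFDerivAt.fun_sum fun k _ => ?_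
    have h1 : HasFDerivAt (fun x : Fin n → ℝ => Real.arctan (x k) - Real.arctan (y k))
        ((1 / (1 + x k ^ 2)) • ContinuousLinearMap.proj (R := ℝ) (φ := fun _ : Fin n => ℝ) k) x :=
      ((hasFDerivAt_apply k x).arctan).sub_const _
    simpa [smul_smul] using h1.pow 2
  rw [pderiv, hder.fderiv]
  simp [Pi.single_apply]
  ring

theorem arctanDist_comm (x y : Fin n → ℝ) : arctanDist x y = arctanDist y x := by
  refine Finset.sum_congr rfl fun i _ => by ring

theorem arctanDist_eikonal (x y : Fin n → ℝ) : arctanDist x y = 1 / 4 * ∑ i, ∑ j,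
    arctanCoeff x i j * pderiv i (fun x' => arctanDist x' y) x *
      pderiv j (fun x' => arctanDist x' y) x := by
  have h : ∀ i, ∑ j, arctanCoeff x i j * pderiv i (fun x' => arctanDist x' y) x *
      pderiv j (fun x' => arctanDist x' y) x =
      4 * (Real.arctan (x i) - Real.arctan (y i)) ^ 2 := by
    intro i
    rw [Finset.sum_eq_single i (fun j _ hj => by simp [arctanCoeff, hj.symm]) (by simp)]
    rw [pderiv_arctanDist, arctanCoeff, Matrix.diagonal_apply_eq]
    have : 1 + x i ^ 2 ≠ 0 := by positivity
    field_simp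
    ring
  rw [Finset.sum_congr rfl fun i _ => h i, ← Finset.mul_sum, ← mul_assoc, arctanDist]
  norm_num

theorem isSolution_arctanDist :
    IsSolution (arctanCoeff (n := n)) univ univ arctanDist where
  isOpen := isOpen_univ
  subset := by simp
  diag _ _ := mem_univ _
  smooth := by
    refine ContDiff.contDiffOn ?_
    unfold arctanDist
    refine ContDiff.sum fun i _ => ContDiff.pow (ContDiff.sub ?_ ?_) 2
    · exact Real.contDiff_arctan.comp (by fun_prop)
    · exact Real.contDiff_arctan.comp (by fun_prop)
  eikonal_x x y _ := arctanDist_eikonal x y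
  eikonal_y x y _ := by
    simp only [fun y' => arctanDist_comm x y']
    exact arctanDist_eikonal y x
  boundary x y _ := by
    rw [arctanDist, Finset.sum_eq_zero_iff_of_nonneg fun i _ => sq_nonneg _]
    simp [sub_eq_zero, Real.arctan_injective.eq_iff, funext_iff]

/-! ### Entire extensions and the obstruction -/

/-- The complex derivative of an extension of a real function. -/
theorem eventually_deriv_eq_of_real {E : ℂ → ℂ} (hE : Differentiable ℂ E) {g g' : ℝ → ℝ}
    (hEg : ∀ᶠ t : ℝ in 𝓝 0, E t = g t) (hg : ∀ t, HasDerivAt g (g' t) t) :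
    ∀ᶠ t : ℝ in 𝓝 0, deriv E t = g' t := by
  filter_upwards [hEg.eventually_nhds] with t ht
  have h1 : HasDerivAt (fun s : ℝ => E s) (deriv E t) t := (hE t).hasDerivAt.comp_ofReal
  exact h1.unique ((hg t).ofReal_comp.congr_of_eventuallyEq ht)

/-- The square of the arctangent near `0` has no entire extension. -/
theorem not_entire_arctan_sq {E : ℂ → ℂ} (hE : Differentiable ℂ E)
    (hEg : ∀ᶠ t : ℝ in 𝓝 0, E t = (Real.arctan t ^ 2 : ℝ)) : False := by
  have hE' : Differentiable ℂ (deriv E) := hE.deriv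
  have h1 := eventually_deriv_eq_of_real hE hEg
    (g' := fun t => 2 * Real.arctan t * (1 / (1 + t ^ 2))) fun t =>
      ((Real.hasDerivAt_arctan t).pow 2).congr_deriv (by simp)
  -- Multiplying by `1 + z²` clears the denominator: on the real axis near `0`, `G` is `2 arctan`,
  -- and the same operation applied to `G` gives the constant 2.
  set G : ℂ → ℂ := fun z => (1 + z ^ 2) * deriv E z with hG
  have hGd : Differentiable ℂ G := by fun_prop
  have h2 : ∀ᶠ t : ℝ in 𝓝 0, G t = (2 * Real.arctan t : ℝ) := by
    filter_upwards [h1] with t ht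
    have : (1 + t ^ 2 : ℝ) ≠ 0 := by positivity
    have h3 : (1 + t ^ 2) * (2 * Real.arctan t * (1 / (1 + t ^ 2))) = 2 * Real.arctan t := by
      field_simp
    rw [hG]
    simp only
    rw [ht]
    exact_mod_cast congrArg (fun s : ℝ => (s : ℂ)) h3
  have h3 := eventually_deriv_eq_of_real hGd h2
    (g' := fun t => 2 * (1 / (1 + t ^ 2))) fun t => (Real.hasDerivAt_arctan t).const_mul 2
  have h4 : ∀ᶠ t : ℝ in 𝓝 0, (1 + (t : ℂ) ^ 2) * deriv G t = 2 := by
    filter_upwards [h3] with t ht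
    have : (1 + t ^ 2 : ℝ) ≠ 0 := by positivity
    have h3 : (1 + t ^ 2) * (2 * (1 / (1 + t ^ 2))) = 2 := by
      field_simp
    rw [ht]
    exact_mod_cast h3
  have h5 : Differentiable ℂ fun z => (1 + z ^ 2) * deriv G z := by
    have := hGd.deriv
    fun_prop
  have htend : Tendsto (fun t : ℝ => (t : ℂ)) (𝓝[≠] 0) (𝓝[≠] 0) := by
    refine tendsto_nhdsWithin_iff.2 ⟨?_, ?_⟩
    · have : ContinuousAt (fun t : ℝ => (t : ℂ)) 0 := Complex.continuous_ofReal.continuousAt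
      simpa [ContinuousAt] using this.tendsto.mono_left nhdsWithin_le_nhds
    · filter_upwards [self_mem_nhdsWithin] with t ht
      simpa using ht
  have h6 : ∃ᶠ z : ℂ in 𝓝[≠] 0, (1 + z ^ 2) * deriv G z = 2 :=
    htend.frequently (h4.filter_mono nhdsWithin_le_nhds).frequently
  -- By the identity theorem the relation holds on all of `ℂ`. At `z = i` the factor `1 + z²`
  -- vanishes and the relation reads `0 = 2`.
  have h7 := (h5.differentiableOn.analyticOnNhd isOpen_univ).eqOn_of_preconnected_of_frequently_eq
    (analyticOnNhd_const (v := (2 : ℂ))) isPreconnected_univ (mem_univ 0) h6 (mem_univ Complex.I)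
  simp at h7

/-- A real power series that converges everywhere has an entire extension. -/
theorem exists_entire_of_hasSum {b : ℕ → ℝ} {g : ℝ → ℝ}
    (h : ∀ t : ℝ, HasSum (fun k => b k * t ^ k) (g t)) :
    ∃ E : ℂ → ℂ, Differentiable ℂ E ∧ ∀ t : ℝ, E t = g t := by
  refine ⟨fun z => ∑' k, (b k : ℂ) * z ^ k, fun z => ?_, fun t => ?_⟩
  · have hz : z ∈ Metric.ball (0 : ℂ) (‖z‖ + 1) := by simp
    -- Convergence at the real point `‖z‖ + 1` is absolute and dominates the complex series on the
    -- disc of that radius.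
    refine (Complex.differentiableOn_tsum_of_summable_norm (h (‖z‖ + 1)).summable.abs (fun k => ?_)
      Metric.isOpen_ball fun k w hw => ?_).differentiableAt (Metric.isOpen_ball.mem_nhds hz)
    · fun_prop
    · rw [mem_ball_zero_iff] at hw
      rw [norm_mul, norm_pow, abs_mul, abs_pow, Complex.norm_real, Real.norm_eq_abs,
        abs_of_pos (show 0 < ‖z‖ + 1 by positivity)]
      gcongr
  · have := (Complex.hasSum_ofReal.2 (h t)).tsum_eq
    push_cast at this
    exact this

/-- On the `i`-th axis every monomial involving another variable vanishes, so the multivariate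
series reduces to one in `t`. -/
theorem hasSum_axis {c : (Fin n → ℕ) → ℝ} {i : Fin n} {t s : ℝ}
    (h : HasSum (fun α => c α * mpow (Pi.single i t) α) s) :
    HasSum (fun k : ℕ => c (Pi.single i k) * t ^ k) s := by
  have hinj : Function.Injective fun k : ℕ => (Pi.single i k : Fin n → ℕ) :=
    Pi.single_injective (M := fun _ : Fin n => ℕ) i
  have hpow : ∀ k : ℕ, mpow (Pi.single i t) (Pi.single i k) = t ^ k := by
    intro k
    rw [mpow, Finset.prod_eq_single i (fun j _ hj => by simp [hj]) (by simp)]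
    simp
  have := (hinj.hasSum_iff (f := fun α => c α * mpow (Pi.single i t) α) ?_).2 h
  · simpa [Function.comp_def, hpow] using this
  · intro α hα
    have : ∃ j, j ≠ i ∧ α j ≠ 0 := by
      by_contra! h0
      refine hα ⟨α i, ?_⟩
      funext j
      by_cases hj : j = i
      · subst hj; simp
      · simp [hj, h0 j hj]
    obtain ⟨j, hj, hαj⟩ := this
    have h0 : mpow (Pi.single i t) α = 0 :=
      Finset.prod_eq_zero (Finset.mem_univ j) (by simp [hj, hαj])
    simp [h0]

/-- Local uniqueness transfers the obstruction from the explicit solution to every solution: near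
the origin of an axis each one equals `arctan² t`. -/
theorem not_isGloballyAnalytic (hn : 1 ≤ n) {D : (Fin n → ℝ) → (Fin n → ℝ) → ℝ}
    (hD : IsSolution arctanCoeff univ univ D) : ¬ IsGloballyAnalytic D := by
  intro hglob
  obtain ⟨c, hc⟩ := hglob 0
  set i : Fin n := ⟨0, hn⟩
  obtain ⟨E, hE, hEg⟩ := exists_entire_of_hasSum (b := fun k => c (Pi.single i k))
    (g := fun t => D (Pi.single i t) 0) fun t => hasSum_axis (by simpa using hc (Pi.single i t))
  refine not_entire_arctan_sq hE ?_
  have hev := hD.eventuallyEq isCoefficientField_arctanCoeff isSolution_arctanDist (mem_univ 0)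
  have hcont : Tendsto (fun t : ℝ => ((Pi.single i t : Fin n → ℝ), (0 : Fin n → ℝ))) (𝓝 0)
      (𝓝 (0, 0)) := by
    have h1 : Continuous fun t : ℝ => (Pi.single i t : Fin n → ℝ) :=
      continuous_single (A := fun _ : Fin n => ℝ) i
    have : ContinuousAt (fun t : ℝ => ((Pi.single i t : Fin n → ℝ), (0 : Fin n → ℝ))) 0 := by
      fun_prop
    simpa [ContinuousAt] using this
  filter_upwards [hcont.eventually hev] with t ht
  rw [hEg, ht, arctanDist, Finset.sum_eq_single i (fun j _ hj => by simp [hj]) (by simp)]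
  simp

end Arctan

end Eikonal

/-! ### The theorem -/

theorem corollary3p1 (n : ℕ) :
    (∀ (Ω : Set (Fin n → ℝ)) (a : (Fin n → ℝ) → Matrix (Fin n) (Fin n) ℝ),
      IsOpen Ω → IsCoefficientField a Ω →
      ∀ (U : Set ((Fin n → ℝ) × (Fin n → ℝ))) (D : (Fin n → ℝ) → (Fin n → ℝ) → ℝ),
      IsSolution a Ω U D → ∀ y ∈ Ω,
        -- the local representation, for every order `M ≥ 3`
        (∀ x, (∀ θ ∈ Icc (0 : ℝ) 1, (y + θ • (x - y), y) ∈ U) → ∀ M : ℕ, 3 ≤ M →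
          (∀ γ ∈ Finset.piAntidiag (Finset.univ : Finset (Fin n)) M,
            IntervalIntegrable (fun θ : ℝ => (1 - θ) ^ (M - 1) *
              mderiv γ (fun x' => D x' y) (y + θ • (x - y))) volume 0 1) ∧
          D x y =
            (∑ i, ∑ j, (a y)⁻¹ i j * (x i - y i) * (x j - y j))
            + (∑ k ∈ Finset.Ico 3 M, ∑ α ∈ Finset.piAntidiag (Finset.univ : Finset (Fin n)) k,
                mderiv α (fun x' => D x' y) y / (mfact α : ℝ) * mpow (x - y) α)
            + (M : ℝ) * ∑ γ ∈ Finset.piAntidiag (Finset.univ : Finset (Fin n)) M,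
                ∫ θ in (0 : ℝ)..1, (1 - θ) ^ (M - 1) * (mpow (x - y) γ / (mfact γ : ℝ)) *
                  mderiv γ (fun x' => D x' y) (y + θ • (x - y))) ∧
        -- coordinates in second order normal form exist
        (∃ (Q : Matrix (Fin n) (Fin n) ℝ) (lam : Fin n → ℝ), IsNormalForm a y Q lam) ∧
        -- in all such coordinates the Taylor coefficients of order at least three satisfy the
        -- recursion and are its only solution
        (∀ (Q : Matrix (Fin n) (Fin n) ℝ) (lam : Fin n → ℝ), IsNormalForm a y Q lam →
          (∀ β, 3 ≤ deg β → taylorCoeff (solInCoords D y Q) 0 β =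
            recursionRHS lam (coeffInCoords a y Q) (taylorCoeff (solInCoords D y Q) 0) β) ∧
          (∀ e : (Fin n → ℕ) → ℝ,
            (∀ β, 3 ≤ deg β → e β = recursionRHS lam (coeffInCoords a y Q) e β) →
            ∀ β, 3 ≤ deg β → e β = taylorCoeff (solInCoords D y Q) 0 β) ∧
          -- the form of the recursion if the coefficient matrix is diagonal near `y`
          ((∀ᶠ z in 𝓝 (0 : Fin n → ℝ), (coeffInCoords a y Q z).IsDiag) →
            (∀ β, 3 ≤ deg β → taylorCoeff (solInCoords D y Q) 0 β =
              diagonalRecursionRHS lam (fun i z => coeffInCoords a y Q z i i)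
                (taylorCoeff (solInCoords D y Q) 0) β) ∧
            (∀ e : (Fin n → ℕ) → ℝ,
              (∀ β, 3 ≤ deg β → e β =
                diagonalRecursionRHS lam (fun i z => coeffInCoords a y Q z i i) e β) →
              ∀ β, 3 ≤ deg β → e β = taylorCoeff (solInCoords D y Q) 0 β))) ∧
        -- uniqueness of the local solution
        (∀ (U' : Set ((Fin n → ℝ) × (Fin n → ℝ))) (D' : (Fin n → ℝ) → (Fin n → ℝ) → ℝ),
          IsSolution a Ω U' D' →
          ∀ᶠ p : (Fin n → ℝ) × (Fin n → ℝ) in 𝓝 (y, y), D p.1 p.2 = D' p.1 p.2)) ∧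
    -- in general there is no global analyticity, even for analytic coefficients
    (1 ≤ n → ∃ a : (Fin n → ℝ) → Matrix (Fin n) (Fin n) ℝ,
      (∀ i j, AnalyticOnNhd ℝ (fun x => a x i j) univ) ∧ IsCoefficientField a univ ∧
      (∃ D : (Fin n → ℝ) → (Fin n → ℝ) → ℝ, IsSolution a univ univ D) ∧
      ∀ D : (Fin n → ℝ) → (Fin n → ℝ) → ℝ, IsSolution a univ univ D →
        ¬ IsGloballyAnalytic D) := by
  refine ⟨fun Ω a _ ha U D hD y hy => ?_, fun hn => ?_⟩
  · have hloc := hD.isLocalSolution ha hy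
    refine ⟨fun x hseg M hM => ⟨fun γ _ => ?_, hloc.taylor hseg hM⟩,
      exists_isNormalForm (ha.posDef y hy), fun Q lam hQ => ?_,
      fun U' D' hD' => hD.eventuallyEq ha hD' hy⟩
    · exact (ContinuousOn.mul (by fun_prop)
        (continuousOn_mderiv_line hloc.isOpen hloc.smooth hseg γ)).intervalIntegrable
    · have hlocQ : IsLocalSolution (coeffInCoords a y Q) _ 0 (solInCoords D y Q) :=
        hloc.inCoords hQ.1
      have hrec : ∀ β, 3 ≤ deg β → taylorCoeff (solInCoords D y Q) 0 β =
          recursionRHS lam (coeffInCoords a y Q) (taylorCoeff (solInCoords D y Q) 0) β :=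
        fun β hβ => hlocQ.taylorCoeff_eq_recursionRHS hQ.inv_coeffInCoords hβ
      refine ⟨hrec, fun e he => recursion_unique he hrec, fun hdiag => ?_⟩
      -- Taylor coefficients depend only on the germ at `0`, so diagonality near `0` removes all
      -- off-diagonal ones.
      obtain ⟨W, hW, hWo, h0W⟩ := eventually_nhds_iff.1 hdiag
      have hA : ∀ i j, i ≠ j → ∀ α,
          taylorCoeff (fun z => coeffInCoords a y Q z i j) 0 α = 0 := by
        intro i j hij α
        rw [taylorCoeff_congr hWo h0W (g := fun _ => 0) (fun z hz => hW z hz hij)]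
        simpa using taylorCoeff_const_mul hWo h0W (f := fun _ => 0) contDiffOn_const 0 α
      simp only [← recursionRHS_eq_diagonalRecursionRHS hA]
      exact ⟨hrec, fun e he => recursion_unique he hrec⟩
  · exact ⟨arctanCoeff, analyticOnNhd_arctanCoeff, isCoefficientField_arctanCoeff,
      ⟨arctanDist, isSolution_arctanDist⟩, fun D hD => not_isGloballyAnalytic hn hD⟩
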